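/- **Model.** A topology $(G,s)$ is a connected undirected graph $G$ on $n$ nodes with a source node $s$. In each synchronous round every node is silent or broadcasts one packet to all its neighbours. *Sender faults:* with a fixed probability $p\in[0,1)$, independently over nodes and rounds, the broadcast of a node is replaced by noise. A node $v$ receives a packet in a round iff $v$ is silent, exactly one neighbour of $v$ broadcasts (a broadcast of noise also counts here), and that neighbour's broadcast is not noise; otherwise $v$ receives nothing, and it never mistakes noise for a packet. At first only $s$ knows the $k$ messages; the goal is that all nodes know all $k$ messages. Messages have $\lceil a\log_2(nk)\rceil$ bits and packets $\lceil b\log_2(nk)\rceil$ bits, for constants $0<a\le b$. An *adaptive routing schedule* gives for each round $r$ a function which, from the set of all pairs $(u,i)$ such that node $u$ knows message $i$ before round $r$, tells each node to be silent or to broadcast one of the messages it knows. A *coding schedule* gives for each node $u$ and round $r$ a function which, from the packets received by $u$ in each earlier round (and, if $u=s$, from the $k$ messages), tells $u$ to be silent or to broadcast an arbitrary packet; at the end each node has to compute all $k$ messages from its own information. Schedules may depend on $(G,s)$. The adaptive routing throughput $\tau^R(G,s)$ and the coding throughput $\tau^{NC}(G,s)$ are $$\limsup_{k\to\infty}\frac{k}{\min|\mathcal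 S_k|},$$ where $|\mathcal S_k|$ is the number of rounds of $\mathcal S_k$, and $\mathcal S_k$ runs over the adaptive routing (respectively coding) schedules that, whatever the $k$ messages are, broadcast them from $s$ to all nodes with probability at least $1-\frac1k$ over the faults. **Theorem.** Fix $p\in[0,1)$ and $0<a\le b$. Let $\min_{G,s}$ be the minimum over all topologies with $n$ nodes. As $n\to\infty$, with sender faults of probability $p$, $$\min_{G,s}\tau^{NC}(G,s)=\Theta\!\left(\frac1{\log n}\right),\qquad \min_{G,s}\tau^{R}(G,s)=\Theta\!\left(\frac1{\log n}\right),$$ and hence the worst case topology gap with adaptive routing satisfies $$\frac{\min_{G,s}\tau^{NC}(G,s)}{\min_{G,s}\tau^{R}(G,s)}=\Theta(1),$$ where the constants in $\Theta(\cdot)$ depend only on $p,a,b$. -/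

import Mathlib

open scoped ENNReal

namespace NoisyRadio

/-! ### One round of the radio network with sender faults -/

section Round

variable {V P : Type}

/-- `act u = some x` means that `u` broadcasts the packet `x` in this round, `act u = none` that it
is silent; `fault u = true` means that a broadcast of `u` in this round is replaced by noise.
Node `v` receives `x` iff `v` is silent, exactly one neighbour `u` of `v` broadcasts, this `u`
broadcasts `x`, and `u` does not fail.  (A faulty broadcast is noise on the channel and still
collides with the other broadcasts.) -/
def Receives (G : SimpleGraph V) (act : V → Option P) (fault : V → Bool) (v : V) (x : P) : Prop :=
  act v = none ∧
    ∃ u, G.Adj v u ∧ act u = some x ∧ fault u = false ∧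
      ∀ w, G.Adj v w → act w ≠ none → w = u

open Classical in
/-- What `v` receives in the round: a packet, or `none` (nothing, a collision or noise). -/
noncomputable def recv (G : SimpleGraph V) (act : V → Option P) (fault : V → Bool) (v : V) :
    Option P :=
  if h : ∃ x, Receives G act fault v x then some h.choose else none

theorem Receives.unique {G : SimpleGraph V} {act : V → Option P} {fault : V → Bool} {v : V}
    {x y : P} (hx : Receives G act fault v x) (hy : Receives G act fault v y) : x = y := by
  obtain ⟨-, u, hu, hux, -, -⟩ := hx
  obtain ⟨-, w, -, hwy, -, hw⟩ := hy
  have huw : u = w := hw u hu (by simp [hux])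
  subst huw
  simpa [hux] using hwy

theorem recv_eq_some_iff {G : SimpleGraph V} {act : V → Option P} {fault : V → Bool} {v : V}
    {x : P} : recv G act fault v = some x ↔ Receives G act fault v x := by
  unfold recv
  split_ifs with h
  · constructor
    · intro hx
      have hx' : h.choose = x := by simpa using hx
      exact hx' ▸ h.choose_spec
    · intro hx
      simpa using h.choose_spec.unique hx
  · constructor
    · intro hx
      simp at hx
    · intro hx
      exact absurd ⟨x, hx⟩ h

end Round

/-! ### Fault probabilities -/

open Classical in
/-- The probability of the event `E` over the fault pattern of `T` rounds, where in each round
each node fails (if it broadcasts) with probability `p`, independently of all other nodes and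
rounds. -/
noncomputable def faultProb {V : Type} [Fintype V] [DecidableEq V] (p : ℝ) (T : ℕ)
    (E : (Fin T → V → Bool) → Prop) : ℝ :=
  ∑ ω : Fin T → V → Bool, if E ω then ∏ t, ∏ v, (if ω t v = true then p else 1 - p) else 0

/-- The fault pattern of round `t`, for a fault pattern of `T` rounds (only `t < T` matters). -/
def faultAt {V : Type} {T : ℕ} (ω : Fin T → V → Bool) (t : ℕ) (v : V) : Bool :=
  if h : t < T then ω ⟨t, h⟩ v else false

/-! ### Adaptive routing -/

section Routing

variable {V : Type} [DecidableEq V] {k : ℕ}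

/-- An adaptive routing schedule for `k` messages. In round `r`, given for every node the set of
messages that it knows by then, it directs each node to be silent (`none`) or to broadcast a
message. -/
abbrev AdaptiveRoutingSchedule (V : Type) (k : ℕ) : Type :=
  ℕ → (V → Finset (Fin k)) → V → Option (Fin k)

/-- What the nodes really broadcast in round `r`: a node that is directed to broadcast a message
which it does not know is silent. -/
def AdaptiveRoutingSchedule.act (σ : AdaptiveRoutingSchedule V k) (r : ℕ)
    (K : V → Finset (Fin k)) (v : V) : Option (Fin k) :=
  (σ r K v).filter fun i => decide (i ∈ K v)

/-- The messages that each node knows before round `t` (rounds are numbered from `0`). -/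
noncomputable def AdaptiveRoutingSchedule.known (σ : AdaptiveRoutingSchedule V k)
    (G : SimpleGraph V) (s : V) (fault : ℕ → V → Bool) : ℕ → V → Finset (Fin k)
  | 0 => fun v => if v = s then Finset.univ else ∅
  | t + 1 => fun v =>
      AdaptiveRoutingSchedule.known σ G s fault t v ∪
        (recv G (σ.act t (AdaptiveRoutingSchedule.known σ G s fault t)) (fault t) v).toFinset

/-- Some adaptive routing schedule of `T` rounds broadcasts `k` messages from `s` to all nodes with
probability at least `1 - 1 / k`. -/
def RoutingFeasible [Fintype V] (p : ℝ) (G : SimpleGraph V) (s : V) (k T : ℕ) : Prop :=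
  ∃ σ : AdaptiveRoutingSchedule V k,
    1 - 1 / (k : ℝ) ≤
      faultProb p T fun ω => ∀ v, σ.known G s (faultAt ω) T v = Finset.univ

end Routing

/-! ### Network coding -/

/-- Length in bits of a message or packet of size `c * log₂ (n k)`. -/
noncomputable def bitLength (c : ℝ) (n k : ℕ) : ℕ := ⌈c * Real.logb 2 ((n : ℝ) * (k : ℝ))⌉₊

section Coding

variable {V M P : Type} [DecidableEq V] {k : ℕ}

/-- A (network) coding schedule for `k` messages in `M` with packets in `P`. In round `r`, node `v`
chooses to be silent (`none`) or to broadcast a packet, as a function of its initial knowledge (the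
`k` messages if `v` is the source, nothing otherwise) and of what it received in the rounds before.
At the end each node computes the messages from the same local information. -/
structure CodingSchedule (V M P : Type) (k : ℕ) where
  send : V → ℕ → Option (Fin k → M) → List (Option P) → Option P
  decode : V → Option (Fin k → M) → List (Option P) → (Fin k → M)

/-- Initially only the source knows the messages. -/
def initKnowledge (s : V) (m : Fin k → M) (v : V) : Option (Fin k → M) :=
  if v = s then some m else none

/-- What each node received in the rounds before round `t`, one entry for each round, in order. -/
noncomputable def CodingSchedule.history (σ : CodingSchedule V M P k) (G : SimpleGraph V) (s : V)
    (m : Fin k → M) (fault : ℕ → V → Bool) : ℕ → V → List (Option P)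
  | 0 => fun _ => []
  | t + 1 => fun v =>
      CodingSchedule.history σ G s m fault t v ++
        [recv G
          (fun u => σ.send u t (initKnowledge s m u) (CodingSchedule.history σ G s m fault t u))
          (fault t) v]

/-- Some coding schedule of `T` rounds, with messages of `bitLength a n k` bits and packets of
`bitLength b n k` bits (`n` the number of nodes), broadcasts any `k` messages from `s` to all nodes
with probability at least `1 - 1 / k`. -/
def CodingFeasible [Fintype V] (p a b : ℝ) (G : SimpleGraph V) (s : V) (k T : ℕ) : Prop :=
  ∃ σ : CodingSchedule V (Fin (bitLength a (Fintype.card V) k) → Bool)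
      (Fin (bitLength b (Fintype.card V) k) → Bool) k,
    ∀ m : Fin k → (Fin (bitLength a (Fintype.card V) k) → Bool),
      1 - 1 / (k : ℝ) ≤
        faultProb p T fun ω =>
          ∀ v, σ.decode v (initKnowledge s m v) (σ.history G s m (faultAt ω) T v) = m

end Coding

/-! ### Throughput and the worst case topology gap -/

/-- `limsup_{k → ∞} k / (least number T of rounds that is feasible for k messages)`. -/
noncomputable def throughput (feasible : ℕ → ℕ → Prop) : ℝ≥0∞ :=
  Filter.limsup (fun k : ℕ => (k : ℝ≥0∞) / ⨅ (T : ℕ) (_ : feasible k T), (T : ℝ≥0∞)) Filter.atTop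

/-- The adaptive routing throughput of the topology `(G, s)` with sender faults. -/
noncomputable def routingThroughput {V : Type} [Fintype V] [DecidableEq V] (p : ℝ)
    (G : SimpleGraph V) (s : V) : ℝ≥0∞ :=
  throughput (RoutingFeasible p G s)

/-- The coding throughput of the topology `(G, s)` with sender faults. -/
noncomputable def codingThroughput {V : Type} [Fintype V] [DecidableEq V] (p a b : ℝ)
    (G : SimpleGraph V) (s : V) : ℝ≥0∞ :=
  throughput (CodingFeasible p a b G s)

/-- The least adaptive routing throughput of a (connected) topology with `n` nodes. -/
noncomputable def worstRoutingThroughput (p : ℝ) (n : ℕ) : ℝ≥0∞ :=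
  ⨅ (G : SimpleGraph (Fin n)) (_ : G.Connected) (s : Fin n), routingThroughput p G s

/-- The least coding throughput of a (connected) topology with `n` nodes. -/
noncomputable def worstCodingThroughput (p a b : ℝ) (n : ℕ) : ℝ≥0∞ :=
  ⨅ (G : SimpleGraph (Fin n)) (_ : G.Connected) (s : Fin n), codingThroughput p a b G s

/-- The worst case topology gap for `n` nodes. -/
noncomputable def worstCaseTopologyGap (p a b : ℝ) (n : ℕ) : ℝ≥0∞ :=
  worstCodingThroughput p a b n / worstRoutingThroughput p n

end NoisyRadio

/-! Sender faults cost only constant factors; the logarithm comes from collisions.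

Achievability. On any connected graph, index the messages of a batch by the permutations `π` of the
nodes. Nodes are layered by distance from the source, and a phase moves a batch one layer on, every
third layer being active. A node hears `π` from the first of its previous-layer neighbours in the
order `π`; if that node is at position `i`, it suffices that the active layer broadcasts only from
positions up to `i`. The `i + 1` rotations of this prefix share one round, each of the prefix nodes
being assigned the message of another rotation. So `n!` messages cost `∑ n!/(i+1)`, about `n! log
n`, rounds per phase (`card_phaseRound_le`, `exists_faultlessSchedule`). To withstand faults, a
message becomes a group of `x` messages and a round a block of `C x` rounds, in which with high
probability every node has `x` fault-free rounds. Adaptive routing repeats a message until all its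
receivers have it (`informed_of_successes`); coding sends a Reed–Solomon codeword
(`estimate_toCoding`).

Converse. Some graph has a set `B` of which, whoever broadcasts, only a fraction `O(1/log n)` has
exactly one broadcasting neighbour (`exists_isBottleneck`). Its nodes choose their neighbourhoods by
pairwise independent hashing at `m` scales, about `log n` of them; a given set of broadcasters is
isolated well at `O(1)` scales only. Counting receptions bounds routing; for coding, few received
packets carry few bits, and the pattern of silent rounds adds only one bit per round, negligible as
packets grow with `k` (`IsBottleneck.bits_le`). -/

namespace NoisyRadio

/-! ### Fault patterns: union and Chernoff bounds -/

section Probability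

variable {V : Type} [Fintype V] [DecidableEq V]

/-- The probability of a single fault pattern. -/
noncomputable def faultWeight (p : ℝ) (T : ℕ) (ω : Fin T → V → Bool) : ℝ :=
  ∏ t, ∏ v, (if ω t v = true then p else 1 - p)

open Classical in
theorem faultProb_eq (p : ℝ) (T : ℕ) (E : (Fin T → V → Bool) → Prop) :
    faultProb p T E = ∑ ω, if E ω then faultWeight p T ω else 0 := rfl

omit [DecidableEq V] in
theorem faultWeight_nonneg {p : ℝ} (hp0 : 0 ≤ p) (hp1 : p ≤ 1) {T : ℕ} (ω : Fin T → V → Bool) :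
    0 ≤ faultWeight p T ω :=
  Finset.prod_nonneg fun t _ => Finset.prod_nonneg fun v _ => by split_ifs <;> linarith

theorem sum_prod_faultPattern {T : ℕ} (f : Fin T → V → Bool → ℝ) :
    ∑ ω : Fin T → V → Bool, ∏ t, ∏ v, f t v (ω t v) = ∏ t, ∏ v, ∑ b, f t v b := by
  simp_rw [Finset.prod_univ_sum, Fintype.piFinset_univ]

theorem sum_faultWeight (p : ℝ) (T : ℕ) : ∑ ω : Fin T → V → Bool, faultWeight p T ω = 1 := by
  unfold faultWeight
  rw [sum_prod_faultPattern (fun _ _ b => if b = true then p else 1 - p)]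
  simp

theorem faultProb_ge_of_union {p : ℝ} (hp0 : 0 ≤ p) (hp1 : p ≤ 1) {T : ℕ} {ι : Type}
    (s : Finset ι) (bad : ι → (Fin T → V → Bool) → Prop) (E : (Fin T → V → Bool) → Prop)
    (h : ∀ ω, (∀ i ∈ s, ¬ bad i ω) → E ω) :
    1 - ∑ i ∈ s, faultProb p T (bad i) ≤ faultProb p T E := by
  classical
  simp only [faultProb_eq]
  rw [← sum_faultWeight (V := V) p T, Finset.sum_comm, ← Finset.sum_sub_distrib]
  refine Finset.sum_le_sum fun ω _ => ?_
  have hw := faultWeight_nonneg hp0 hp1 ω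
  have hnn : ∀ i ∈ s, 0 ≤ if bad i ω then faultWeight p T ω else 0 := fun i _ => by
    split_ifs <;> simp [hw]
  by_cases hE : E ω
  · simpa [hE] using Finset.sum_nonneg hnn
  · have : ∃ i ∈ s, bad i ω := by
      by_contra! hc
      exact hE (h ω hc)
    obtain ⟨i, hi, hb⟩ := this
    have := Finset.single_le_sum hnn hi
    simp only [hb, if_true] at this
    simp [hE, this]

theorem exists_of_faultProb_pos {p : ℝ} {T : ℕ} {E : (Fin T → V → Bool) → Prop}
    (h : 0 < faultProb p T E) : ∃ ω, E ω := by
  classical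
  by_contra! hc
  simp [faultProb_eq, hc] at h

/-- Chernoff bound for the number of rounds of `I` in which `u` does not fail. -/
theorem faultProb_few_successes {p : ℝ} (hp0 : 0 ≤ p) (hp1 : p ≤ 1) {T : ℕ} (I : Finset (Fin T))
    (u : V) (x : ℕ) :
    faultProb p T (fun ω => (I.filter fun t => ω t u = false).card < x) ≤
      2 ^ x * ((1 + p) / 2) ^ I.card := by
  classical
  -- Exponential moment: a factor `1/2` for each success has mean `p + (1 - p)/2 = (1 + p)/2` per
  -- round of `I`. Markov's inequality then gives the bound.
  have key : ∑ ω : Fin T → V → Bool,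
      faultWeight p T ω * ∏ t ∈ I, (if ω t u = true then (1 : ℝ) else 1 / 2) =
        ((1 + p) / 2) ^ I.card := by
    have h1 : ∀ ω : Fin T → V → Bool,
        faultWeight p T ω * ∏ t ∈ I, (if ω t u = true then (1 : ℝ) else 1 / 2) =
        ∏ t, ∏ v, ((if ω t v = true then p else 1 - p) *
          (if t ∈ I ∧ v = u then (if ω t v = true then (1 : ℝ) else 1 / 2) else 1)) := by
      intro ω
      simp only [faultWeight, Finset.prod_mul_distrib]
      congr 1
      rw [← Finset.prod_subset (Finset.subset_univ I)]
      · refine Finset.prod_congr rfl fun t ht => ?_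
        simp [ht]
      · intro t _ ht
        simp [ht]
    simp_rw [h1]
    rw [sum_prod_faultPattern (fun t v b => (if b = true then p else 1 - p) *
          (if t ∈ I ∧ v = u then (if b = true then (1 : ℝ) else 1 / 2) else 1)),
      ← Finset.prod_subset (Finset.subset_univ I)]
    · rw [← Finset.prod_const]
      refine Finset.prod_congr rfl fun t ht => ?_
      rw [Finset.prod_eq_single u]
      · simp [ht]; ring
      · intro v _ hv
        simp [hv]
      · simp
    · intro t _ ht
      simp [ht]
  rw [faultProb_eq, ← key, Finset.mul_sum]
  refine Finset.sum_le_sum fun ω _ => ?_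
  have hw := faultWeight_nonneg hp0 hp1 ω
  have h2 : ∏ t ∈ I, (if ω t u = true then (1 : ℝ) else 1 / 2) =
      (1 / 2) ^ (I.filter fun t => ω t u = false).card := by
    rw [← Finset.prod_const, Finset.prod_filter]
    refine Finset.prod_congr rfl fun t _ => ?_
    cases ω t u <;> simp
  rw [h2]
  split_ifs with hc
  · have h3 : (1 : ℝ) ≤ 2 ^ x * (1 / 2) ^ (I.filter fun t => ω t u = false).card := by
      calc (1 : ℝ) = 2 ^ x * (1 / 2) ^ x := by rw [← mul_pow]; norm_num
        _ ≤ _ := by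
          gcongr 2 ^ x * ?_
          exact pow_le_pow_of_le_one (by norm_num) (by norm_num) hc.le
    nlinarith
  · positivity

/-- In each of `T₀` blocks of `L` rounds, each node does not fail in at least `x` rounds. -/
def GoodFaults (T₀ L x : ℕ) (ω : Fin (T₀ * L) → V → Bool) : Prop :=
  ∀ g < T₀, ∀ u, x ≤ ((Finset.range L).filter fun z => faultAt ω (g * L + z) u = false).card

/-- Union bound over the `T₀ * |V|` pairs of a block and a node. It reduces both simulations to
deterministic statements about good fault patterns. -/
theorem faultProb_of_goodFaults {p : ℝ} (hp0 : 0 ≤ p) (hp1 : p ≤ 1) {T₀ L x : ℕ}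
    {E : (Fin (T₀ * L) → V → Bool) → Prop} (h : ∀ ω, GoodFaults T₀ L x ω → E ω) :
    1 - (T₀ * Fintype.card V : ℝ) * (2 ^ x * ((1 + p) / 2) ^ L) ≤ faultProb p (T₀ * L) E := by
  classical
  have hlt : ∀ (g : Fin T₀) (z : Fin L), g.1 * L + z.1 < T₀ * L := fun g z => by
    have := Nat.mul_le_mul_right L (Nat.succ_le_of_lt g.2)
    have := z.2
    rw [Nat.succ_mul] at *
    omega
  let emb : Fin T₀ → Fin L ↪ Fin (T₀ * L) := fun g =>
    ⟨fun z => ⟨g.1 * L + z.1, hlt g z⟩, fun z z' hz => by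
      simpa [Fin.ext_iff] using hz⟩
  let I : Fin T₀ → Finset (Fin (T₀ * L)) := fun g => Finset.univ.map (emb g)
  have hI : ∀ g, (I g).card = L := fun g => by simp [I]
  refine le_trans ?_ (faultProb_ge_of_union hp0 hp1 (Finset.univ : Finset (Fin T₀ × V))
    (fun gu ω => ((I gu.1).filter fun t => ω t gu.2 = false).card < x) E ?_)
  · gcongr
    calc _ ≤ ∑ gu : Fin T₀ × V, (2 : ℝ) ^ x * ((1 + p) / 2) ^ L :=
          Finset.sum_le_sum fun gu _ => by
            simpa [hI] using faultProb_few_successes hp0 hp1 (I gu.1) gu.2 x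
      _ = _ := by simp
  · intro ω hω
    refine h ω fun g hg u => ?_
    have := hω (⟨g, hg⟩, u) (Finset.mem_univ _)
    rw [not_lt] at this
    refine this.trans ?_
    rw [Finset.filter_map, Finset.card_map]
    refine Finset.card_le_card_of_injOn (fun z => z.1) ?_ ?_
    · intro z hz
      have h1 := hlt ⟨g, hg⟩ z
      simp only [Finset.coe_filter, Set.mem_ofPred_eq, Finset.mem_univ, true_and,
        Function.comp] at hz
      simp only [Finset.coe_filter, Set.mem_ofPred_eq, Finset.mem_range, z.2, true_and]
      simp only [faultAt, h1, dif_pos]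
      exact hz
    · intro z _ z' _ hz
      exact Fin.ext hz

end Probability

/-- A non-adaptive schedule for a network without faults, of `T₀` rounds for messages indexed by
`κ`, together with a certificate of its correctness: node `v` learns message `h` from its neighbour
`parent v h` in round `learn v h`. -/
structure FaultlessSchedule {V : Type} (G : SimpleGraph V) (s : V) (κ : Type) (T₀ : ℕ) where
  act : ℕ → V → Option κ
  learn : V → κ → ℕ
  parent : V → κ → V
  learn_lt : ∀ v h, v ≠ s → learn v h < T₀
  adj_parent : ∀ v h, v ≠ s → G.Adj v (parent v h)
  act_self : ∀ v h, v ≠ s → act (learn v h) v = none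
  act_parent : ∀ v h, v ≠ s → act (learn v h) (parent v h) = some h
  eq_parent : ∀ v h, v ≠ s → ∀ w, G.Adj v w → act (learn v h) w ≠ none → w = parent v h
  parent_knows : ∀ v h, v ≠ s → parent v h = s ∨ learn (parent v h) h < learn v h

/-! ### Permutations up to rotation of a prefix -/

section Rotation

open Equiv

variable {n : ℕ}

/-- A power of a cycle that fixes a point of the cycle is trivial. Hence the messages sharing a
round have distinct senders. -/
theorem eq_one_of_mem_zpowers_cycleRange {i : Fin n} {σ : Perm (Fin n)}
    (hσ : σ ∈ Subgroup.zpowers (Fin.cycleRange i)) (hi : σ i = i) : σ = 1 := by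
  have : NeZero n := ⟨by have := i.2; omega⟩
  rw [← (isOfFinOrder_of_finite _).mem_powers_iff_mem_zpowers] at hσ
  obtain ⟨m, rfl⟩ := hσ
  by_cases h0 : i = 0
  · subst h0
    simp
  · refine ((Fin.isCycle_cycleRange h0).pow_eq_one_iff' (x := i) ?_).2 hi
    rw [Fin.cycleRange_self]
    exact fun h => h0 h.symm

/-- Indices beyond `i` are fixed by the rotation, so none of them is the image of `i`. Hence all
senders of a class lie in the common prefix. -/
theorem apply_le_of_mem_zpowers_cycleRange {i : Fin n} {σ : Perm (Fin n)}
    (hσ : σ ∈ Subgroup.zpowers (Fin.cycleRange i)) : σ i ≤ i := by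
  obtain ⟨m, rfl⟩ := hσ
  by_contra! hlt
  set j := (Fin.cycleRange i ^ m) i with hj
  have hfix : (Fin.cycleRange i ^ m) j = j :=
    Equiv.Perm.zpow_apply_eq_self_of_apply_eq_self (Fin.cycleRange_of_gt hlt) m
  have : j = i := (Fin.cycleRange i ^ m).injective (hfix.trans hj)
  exact hlt.ne this.symm

/-- The rounds of a phase: a prefix length and a class of permutations, two permutations being
equivalent if they differ by a rotation of the prefix. -/
abbrev PhaseRound (n : ℕ) : Type :=
  Σ i : Fin n, Perm (Fin n) ⧸ Subgroup.zpowers (Fin.cycleRange i)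

theorem orderOf_cycleRange (i : Fin n) : orderOf (Fin.cycleRange i) = i + 1 := by
  have : NeZero n := ⟨by have := i.2; omega⟩
  by_cases h0 : i = 0
  · subst h0
    simp
  · rw [← Equiv.Perm.lcm_cycleType, Fin.cycleType_cycleRange h0]
    simp

/-- A rotation class at `i` has `i + 1` elements, so the classes number `n!/(i+1)` and the sum is
harmonic. -/
theorem card_phaseRound_le (n : ℕ) :
    (Nat.card (PhaseRound n) : ℝ) ≤ n.factorial * (1 + Real.log n) := by
  have h1 : ∀ i : Fin n, (Nat.card (Perm (Fin n) ⧸ Subgroup.zpowers (Fin.cycleRange i)) : ℝ) =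
      n.factorial * ((i : ℝ) + 1)⁻¹ := by
    intro i
    have h := Subgroup.card_eq_card_quotient_mul_card_subgroup
      (Subgroup.zpowers (Fin.cycleRange i))
    rw [Nat.card_zpowers, orderOf_cycleRange, Nat.card_perm, Nat.card_fin] at h
    rw [h]
    push_cast
    field_simp
  calc (Nat.card (PhaseRound n) : ℝ) = n.factorial * harmonic n := by
        rw [Nat.card_sigma, harmonic]
        push_cast
        simp_rw [h1, ← Finset.mul_sum]
        rw [Fin.sum_univ_eq_sum_range (fun i => ((i : ℝ) + 1)⁻¹)]
    _ ≤ _ := by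
        gcongr
        exact harmonic_le_one_add_log n

end Rotation

/-! ### Pipelined broadcast without faults -/

section Construction

open Equiv

theorem exists_adj_dist_succ {V : Type} {G : SimpleGraph V}
    (hG : G.Connected) {s v : V} (hv : v ≠ s) : ∃ u, G.Adj v u ∧ G.dist s u + 1 = G.dist s v := by
  obtain ⟨w, hw⟩ := hG.exists_walk_length_eq_dist v s
  cases w with
  | nil => exact absurd rfl hv
  | @cons _ u _ h w =>
    refine ⟨u, h, ?_⟩
    rw [SimpleGraph.Walk.length_cons] at hw
    have h1 := SimpleGraph.dist_le w
    have h2 := hG.dist_triangle (u := v) (v := u) (w := s)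
    rw [SimpleGraph.dist_eq_one_iff_adj.2 h] at h2
    rw [SimpleGraph.dist_comm (u := s) (v := u), SimpleGraph.dist_comm (u := s) (v := v)]
    omega

theorem dist_lt_card {V : Type} [Fintype V] {G : SimpleGraph V}
    (hG : G.Connected) (s v : V) : G.dist s v < Fintype.card V := by
  obtain ⟨w, hw, hl⟩ := hG.exists_path_of_dist s v
  rw [← hl]
  exact hw.length_lt

theorem mul_add_eq_mul_add_iff {H x y a b : ℕ} (ha : a < H) (hb : b < H) :
    x * H + a = y * H + b ↔ x = y ∧ a = b := by
  refine ⟨fun h => ?_, fun ⟨h, h'⟩ => by rw [h, h']⟩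
  have hx : (x * H + a) / H = x := by
    rw [Nat.mul_comm, Nat.mul_add_div (by omega), Nat.div_eq_of_lt ha, add_zero]
  have hy : (y * H + b) / H = y := by
    rw [Nat.mul_comm, Nat.mul_add_div (by omega), Nat.div_eq_of_lt hb, add_zero]
  have hxy : x = y := by rw [← hx, h, hy]
  subst hxy
  exact ⟨rfl, by omega⟩

/-- Batches start three phases apart and each needs fewer than `n` phases. Active layers are thus
congruent modulo 3, so a listening node and its neighbours meet only one of them. -/
theorem exists_faultlessSchedule {n : ℕ} {G : SimpleGraph (Fin n)} (hG : G.Connected) (s : Fin n)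
    (B : ℕ) : Nonempty (FaultlessSchedule G s (Fin B × Perm (Fin n))
      ((3 * (B + n)) * Nat.card (PhaseRound n))) := by
  classical
  have : Nonempty (Fin n) := ⟨s⟩
  set H := Nat.card (PhaseRound n) with hH
  let e : PhaseRound n ≃ Fin H := Finite.equivFin _
  let code : Fin n → Perm (Fin n) → ℕ := fun i π => e ⟨i, QuotientGroup.mk π⟩
  have hcode_lt : ∀ i π, code i π < H := fun i π => (e _).2
  have hcode : ∀ i π i' π', code i π = code i' π' →
      i = i' ∧ π⁻¹ * π' ∈ Subgroup.zpowers (Fin.cycleRange i) := by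
    intro i π i' π' h
    have h1 := e.injective (Fin.ext h)
    obtain rfl : i = i' := congrArg Sigma.fst h1
    refine ⟨rfl, QuotientGroup.eq.1 ?_⟩
    simpa using h1
  -- Layer `d` forwards batch `b` in phase `3 b + d`, a phase having `H` rounds. In the round of `i`
  -- and the class of `π`, the sender of `π` is the node at position `i`.
  let Sends : ℕ → Fin n → Fin B × Perm (Fin n) → Prop := fun g u h =>
    ∃ i, g = (3 * h.1 + G.dist s u) * H + code i h.2 ∧ h.2 i = u
  have hSends : ∀ g u h h', Sends g u h → Sends g u h' → h = h' := by
    rintro g u ⟨b, π⟩ ⟨b', π'⟩ ⟨i, hg, hu⟩ ⟨i', hg', hu'⟩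
    rw [hg, mul_add_eq_mul_add_iff (hcode_lt _ _) (hcode_lt _ _)] at hg'
    obtain ⟨h1, h2⟩ := hg'
    obtain ⟨rfl, h3⟩ := hcode _ _ _ _ h2
    have h4 : (π⁻¹ * π') i = i := by
      simp only [Perm.mul_apply] at hu hu' ⊢
      rw [hu', ← hu]; simp
    have h5 := eq_one_of_mem_zpowers_cycleRange h3 h4
    rw [inv_mul_eq_one] at h5
    simp only at h1
    exact Prod.ext (Fin.ext (by simp only; omega)) h5
  let act : ℕ → Fin n → Option (Fin B × Perm (Fin n)) := fun g u =>
    if h : ∃ x, Sends g u x then some h.choose else none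
  have hact : ∀ g u x, Sends g u x → act g u = some x := by
    intro g u x hx
    have h : ∃ x, Sends g u x := ⟨x, hx⟩
    simp only [act, dif_pos h]
    exact congrArg some (hSends _ _ _ _ h.choose_spec hx)
  have hfirst : ∀ (v : Fin n) (π : Perm (Fin n)), v ≠ s → ∃ i, (G.Adj v (π i) ∧ G.dist s (π i) + 1 = G.dist s v) ∧
      ∀ i' < i, ¬ (G.Adj v (π i') ∧ G.dist s (π i') + 1 = G.dist s v) := by
    intro v π hv
    obtain ⟨u, hu⟩ := exists_adj_dist_succ hG hv
    have hne : {i : Fin n | G.Adj v (π i) ∧ G.dist s (π i) + 1 = G.dist s v}.Nonempty :=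
      ⟨π⁻¹ u, by simpa using hu⟩
    refine ⟨wellFounded_lt.min _ hne, wellFounded_lt.min_mem _ hne, fun i' hi' h => ?_⟩
    exact wellFounded_lt.not_lt_min
      {i : Fin n | G.Adj v (π i) ∧ G.dist s (π i) + 1 = G.dist s v} h hi'
  choose! first hfirst₁ hfirst₂ using hfirst
  have hsend : ∀ v (h : Fin B × Perm (Fin n)), v ≠ s →
      Sends ((3 * h.1 + G.dist s v - 1) * H + code (first v h.2) h.2) (h.2 (first v h.2)) h := by
    intro v h hv
    refine ⟨first v h.2, ?_, rfl⟩
    have := (hfirst₁ v h.2 hv).2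
    congr 2
    omega
  refine ⟨{
    act := act
    learn := fun v h => (3 * h.1 + G.dist s v - 1) * H + code (first v h.2) h.2
    parent := fun v h => h.2 (first v h.2)
    learn_lt := ?_
    adj_parent := fun v h hv => (hfirst₁ v h.2 hv).1
    act_self := ?_
    act_parent := fun v h hv => hact _ _ _ (hsend v h hv)
    eq_parent := ?_
    parent_knows := ?_ }⟩
  · intro v h _
    have h1 := hcode_lt (first v h.2) h.2
    have h2 := dist_lt_card hG s v
    rw [Fintype.card_fin] at h2
    have h3 := h.1.2
    calc _ < (3 * h.1 + G.dist s v - 1) * H + H := by omega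
      _ = (3 * h.1 + G.dist s v - 1 + 1) * H := by ring
      _ ≤ _ := Nat.mul_le_mul_right _ (by omega)
  · intro v h hv
    -- A node sends only in phases congruent to its distance modulo 3; the present phase is one
    -- short of that.
    have h1 := (hfirst₁ v h.2 hv).2
    simp only [act]
    rw [dif_neg]
    rintro ⟨h', i, hg, -⟩
    rw [mul_add_eq_mul_add_iff (hcode_lt _ _) (hcode_lt _ _)] at hg
    omega
  · intro v h hv w hw hne
    have hw' : ∃ x, Sends ((3 * h.1 + G.dist s v - 1) * H + code (first v h.2) h.2) w x := by
      by_contra hc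
      exact hne (by simp only [act]; rw [dif_neg hc])
    obtain ⟨h', i, hg, hi⟩ := hw'
    rw [mul_add_eq_mul_add_iff (hcode_lt _ _) (hcode_lt _ _)] at hg
    obtain ⟨hg1, hg2⟩ := hg
    have hv1 := (hfirst₁ v h.2 hv).2
    -- Adjacent distances differ by at most 1, and the phase fixes the sender's distance modulo 3.
    have hdist : G.dist s w + 1 = G.dist s v := by
      have a1 := hG.dist_triangle (u := s) (v := v) (w := w)
      have a2 := hG.dist_triangle (u := s) (v := w) (w := v)
      rw [SimpleGraph.dist_eq_one_iff_adj.2 hw] at a1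
      rw [SimpleGraph.dist_eq_one_iff_adj.2 hw.symm] at a2
      omega
    obtain ⟨hi', hmem⟩ := hcode _ _ _ _ hg2
    set i₀ := first v h.2 with hi₀
    -- `(h.2⁻¹ * h'.2) i₀` is the position of `w` in the order `h.2`. It is at most `i₀`, which is
    -- the first position of a possible parent.
    have hle := apply_le_of_mem_zpowers_cycleRange hmem
    have hwi : h.2 ((h.2⁻¹ * h'.2) i₀) = w := by
      simp [hi', hi]
    rcases hle.lt_or_eq with hlt | heq
    · exact absurd (by rw [hwi]; exact ⟨hw, hdist⟩) (hfirst₂ v h.2 hv _ hlt)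
    · rw [← hwi, heq]
  · intro v h hv
    by_cases hs : h.2 (first v h.2) = s
    · exact Or.inl hs
    · right
      have h1 := (hfirst₁ v h.2 hv).2
      have h2 := (hfirst₁ _ h.2 hs).2
      have h3 := hcode_lt (first (h.2 (first v h.2)) h.2) h.2
      calc _ < (3 * h.1 + G.dist s (h.2 (first v h.2)) - 1) * H + H := by omega
        _ = (3 * h.1 + G.dist s (h.2 (first v h.2)) - 1 + 1) * H := by ring
        _ ≤ (3 * h.1 + G.dist s v - 1) * H := Nat.mul_le_mul_right _ (by omega)
        _ ≤ _ := Nat.le_add_right _ _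

end Construction

/-! ### Simulation by adaptive routing -/

theorem blockIndex_div {g L z : ℕ} (hz : z < L) : (g * L + z) / L = g := by
  rw [Nat.mul_comm, Nat.mul_add_div (by omega), Nat.div_eq_of_lt hz, add_zero]

section Known

variable {V : Type} [DecidableEq V] {k : ℕ}

theorem AdaptiveRoutingSchedule.known_subset_succ (σ : AdaptiveRoutingSchedule V k)
    (G : SimpleGraph V) (s : V) (fault : ℕ → V → Bool) (t : ℕ) (v : V) :
    σ.known G s fault t v ⊆ σ.known G s fault (t + 1) v :=
  Finset.subset_union_left

theorem AdaptiveRoutingSchedule.known_mono (σ : AdaptiveRoutingSchedule V k)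
    (G : SimpleGraph V) (s : V) (fault : ℕ → V → Bool) (v : V) :
    Monotone fun t => σ.known G s fault t v :=
  monotone_nat_of_le_succ fun t => σ.known_subset_succ G s fault t v

theorem AdaptiveRoutingSchedule.known_source (σ : AdaptiveRoutingSchedule V k)
    (G : SimpleGraph V) (s : V) (fault : ℕ → V → Bool) (t : ℕ) :
    σ.known G s fault t s = Finset.univ := by
  refine Finset.univ_subset_iff.1 ((?_ : Finset.univ ⊆ σ.known G s fault 0 s).trans
    (σ.known_mono G s fault s (Nat.zero_le t)))
  simp [AdaptiveRoutingSchedule.known]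

theorem AdaptiveRoutingSchedule.mem_known_of_receives {σ : AdaptiveRoutingSchedule V k}
    {G : SimpleGraph V} {s : V} {fault : ℕ → V → Bool} {t : ℕ} {v : V} {i : Fin k}
    (h : Receives G (σ.act t (σ.known G s fault t)) (fault t) v i) :
    i ∈ σ.known G s fault (t + 1) v := by
  simp [AdaptiveRoutingSchedule.known, recv_eq_some_iff.2 h]

end Known

namespace FaultlessSchedule

variable {V κ : Type} [DecidableEq V] {G : SimpleGraph V} {s : V} {T₀ : ℕ}

section Routing

variable (F : FaultlessSchedule G s κ T₀) {k x : ℕ} (e : Fin k ≃ κ × Fin x) (L : ℕ)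

/-- All nodes that are to learn the group `h` from `u` in block `g` know its message `y`. -/
def Informed (K : V → Finset (Fin k)) (g : ℕ) (u : V) (h : κ) (y : Fin x) : Prop :=
  ∀ v, v ≠ s → F.learn v h = g → F.parent v h = u → e.symm (h, y) ∈ K v

open Classical in
/-- Every round of `F` becomes a block of `L` rounds, and every message of `F` a group of `x`
messages. A sender broadcasts the first message of the group that some child lacks. -/
noncomputable def toRouting : AdaptiveRoutingSchedule V k := fun r K u =>
  match F.act (r / L) u with
  | none => none
  | some h =>
    if hy : ∃ y : Fin x, ¬ F.Informed e K (r / L) u h y ∧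
        ∀ y' < y, F.Informed e K (r / L) u h y' then
      some (e.symm (h, hy.choose))
    else none

omit [DecidableEq V] in
theorem toRouting_eq_none {r : ℕ} {K : V → Finset (Fin k)} {u : V} (h : F.act (r / L) u = none) :
    (F.toRouting e L).act r K u = none := by
  simp [AdaptiveRoutingSchedule.act, toRouting, h]

omit [DecidableEq V] in
theorem toRouting_spec {r : ℕ} {K : V → Finset (Fin k)} {u : V} {h : κ}
    (hact : F.act (r / L) u = some h) (hK : ∀ y, e.symm (h, y) ∈ K u) :
    (∀ y, F.Informed e K (r / L) u h y) ∨
      ∃ y, (F.toRouting e L).act r K u = some (e.symm (h, y)) ∧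
        ¬ F.Informed e K (r / L) u h y ∧ ∀ y' < y, F.Informed e K (r / L) u h y' := by
  classical
  by_cases hall : ∀ y, F.Informed e K (r / L) u h y
  · exact Or.inl hall
  · right
    have hy : ∃ y : Fin x, ¬ F.Informed e K (r / L) u h y ∧
        ∀ y' < y, F.Informed e K (r / L) u h y' := by
      have hne : {y : Fin x | ¬ F.Informed e K (r / L) u h y}.Nonempty := not_forall.1 hall
      refine ⟨wellFounded_lt.min _ hne, wellFounded_lt.min_mem _ hne, fun y' hy' => ?_⟩
      by_contra hc
      exact wellFounded_lt.not_lt_min {y : Fin x | ¬ F.Informed e K (r / L) u h y} hc hy'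
    refine ⟨hy.choose, ?_, hy.choose_spec⟩
    simp only [AdaptiveRoutingSchedule.act, toRouting, hact, dif_pos hy]
    simp [hK]

variable {F e L}

-- The broadcasters of a block are among those of the simulated round, and fewer broadcasters create
-- no collision. So only the parent's fault matters.
omit [DecidableEq V] in
theorem toRouting_receives {fault : ℕ → V → Bool} {r : ℕ} {K : V → Finset (Fin k)} {v : V} {h : κ}
    {i : Fin k} (hv : v ≠ s) (hr : F.learn v h = r / L)
    (hact : (F.toRouting e L).act r K (F.parent v h) = some i)
    (hf : fault r (F.parent v h) = false) :
    Receives G ((F.toRouting e L).act r K) (fault r) v i := by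
  refine ⟨F.toRouting_eq_none e L (hr ▸ F.act_self v h hv), F.parent v h, F.adj_parent v h hv,
    hact, hf, fun w hw hne => F.eq_parent v h hv w hw fun hc => hne ?_⟩
  exact F.toRouting_eq_none e L (hr ▸ hc)

/-- A fault-free broadcast reaches all children of the block at once, so each success completes the
first incomplete message of the group. -/
theorem informed_of_successes {fault : ℕ → V → Bool} {g : ℕ} {u : V} {h : κ}
    (hact : F.act g u = some h)
    (hK : ∀ y, e.symm (h, y) ∈ (F.toRouting e L).known G s fault (g * L) u) :
    ∀ t ≤ L, ∀ y : Fin x,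
      (y : ℕ) < ((Finset.range t).filter fun z => fault (g * L + z) u = false).card →
      F.Informed e ((F.toRouting e L).known G s fault (g * L + t)) g u h y := by
  intro t
  induction t with
  | zero => simp
  | succ t ih =>
    intro ht y hy
    have hmono := fun v => (F.toRouting e L).known_subset_succ G s fault (g * L + t) v
    have hdiv := blockIndex_div (g := g) (Nat.lt_of_succ_le ht)
    rw [Finset.range_add_one, Finset.filter_insert] at hy
    by_cases hf : fault (g * L + t) u = false
    · rw [if_pos hf, Finset.card_insert_of_notMem (by simp)] at hy
      have hK' : ∀ y, e.symm (h, y) ∈ (F.toRouting e L).known G s fault (g * L + t) u :=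
        fun y => (F.toRouting e L).known_mono G s fault u (Nat.le_add_right _ _) (hK y)
      rcases F.toRouting_spec e L (hdiv.symm ▸ hact) hK' with hall | ⟨y₀, hy₀, hnot, hlt⟩
      · rw [hdiv] at hall
        exact fun v hv h1 h2 => hmono v (hall y v hv h1 h2)
      · rw [hdiv] at hlt hnot
        rcases lt_trichotomy y y₀ with hyy | rfl | hyy
        · exact fun v hv h1 h2 => hmono v (hlt y hyy v hv h1 h2)
        · intro v hv h1 h2
          subst h2
          exact AdaptiveRoutingSchedule.mem_known_of_receives
            (toRouting_receives hv (h1.trans hdiv.symm) hy₀ hf)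
        -- Here `y₀` is below the number of earlier successes, so it was already complete.
        · have : (y₀ : ℕ) < y := hyy
          exact absurd (ih (by omega) y₀ (by omega)) hnot
    · rw [if_neg hf] at hy
      exact fun v hv h1 h2 => hmono v (ih (by omega) y hy v hv h1 h2)

/-- Induction on the learning round: the parent is the source or has the whole group before the
block begins. -/
theorem mem_known_toRouting {fault : ℕ → V → Bool}
    (hgood : ∀ g < T₀, ∀ u,
      x ≤ ((Finset.range L).filter fun z => fault (g * L + z) u = false).card) :
    ∀ N v h, v ≠ s → F.learn v h < N → ∀ t, (F.learn v h + 1) * L ≤ t → ∀ y,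
      e.symm (h, y) ∈ (F.toRouting e L).known G s fault t v := by
  intro N
  induction N with
  | zero => simp
  | succ N ih =>
    intro v h hv hN t ht y
    have hK : ∀ y, e.symm (h, y) ∈
        (F.toRouting e L).known G s fault (F.learn v h * L) (F.parent v h) := by
      intro y
      rcases F.parent_knows v h hv with hs | hlt
      · rw [hs, AdaptiveRoutingSchedule.known_source]
        exact Finset.mem_univ _
      · by_cases hs : F.parent v h = s
        · rw [hs, AdaptiveRoutingSchedule.known_source]
          exact Finset.mem_univ _
        · exact ih _ h hs (by omega) _ (Nat.mul_le_mul_right _ hlt) y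
    have := informed_of_successes (F.act_parent v h hv) hK L le_rfl y
      (y.2.trans_le (hgood _ (F.learn_lt v h hv) _)) v hv rfl rfl
    refine (F.toRouting e L).known_mono G s fault v ?_ this
    rwa [Nat.succ_mul] at ht

end Routing

theorem routingFeasible [Fintype V] (F : FaultlessSchedule G s κ T₀) {k x L : ℕ}
    (e : Fin k ≃ κ × Fin x) {p : ℝ} (hp0 : 0 ≤ p) (hp1 : p ≤ 1)
    (hk : (T₀ * Fintype.card V : ℝ) * (2 ^ x * ((1 + p) / 2) ^ L) ≤ 1 / k) :
    RoutingFeasible p G s k (T₀ * L) := by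
  refine ⟨F.toRouting e L, le_trans (by linarith) (faultProb_of_goodFaults hp0 hp1 (x := x) ?_)⟩
  intro ω hω v
  by_cases hv : v = s
  · rw [hv, AdaptiveRoutingSchedule.known_source]
  · refine Finset.eq_univ_of_forall fun i => ?_
    have := F.learn_lt v (e i).1 hv
    simpa using mem_known_toRouting (F := F) (e := e) hω (F.learn v (e i).1 + 1) v (e i).1 hv
      (Nat.lt_succ_self _) (T₀ * L) (Nat.mul_le_mul_right _ this) (e i).2

end FaultlessSchedule

/-! ### Erasure codes and simulation by coding -/

section ErasureCode

/-- Any `x` of the first `L` symbols of `enc μ` determine `μ`. -/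
def IsErasureCode {M P : Type} {x : ℕ} (L : ℕ) (enc : (Fin x → M) → ℕ → P) : Prop :=
  ∀ Z ⊆ Finset.range L, x ≤ Z.card → ∀ μ μ', (∀ z ∈ Z, enc μ z = enc μ' z) → μ = μ'

/-- Reed–Solomon codes. -/
theorem exists_isErasureCode_field (F : Type) [Field F] [Fintype F] (x : ℕ) {L : ℕ}
    (hL : L ≤ Fintype.card F) : ∃ enc : (Fin x → F) → ℕ → F, IsErasureCode L enc := by
  classical
  obtain ⟨f⟩ : Nonempty (Fin L ↪ F) :=
    Function.Embedding.nonempty_of_card_le (by simpa using hL)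
  let pt : ℕ → F := fun z => if h : z < L then f ⟨z, h⟩ else 0
  have hpt : Set.InjOn pt (Finset.range L : Set ℕ) := by
    intro z hz z' hz' h
    simp only [Finset.coe_range, Set.mem_Iio] at hz hz'
    simp only [pt, hz, hz', dif_pos] at h
    simpa using f.injective h
  let poly : (Fin x → F) → Polynomial F := fun μ => ∑ y, Polynomial.C (μ y) * Polynomial.X ^ (y : ℕ)
  have hdeg : ∀ μ, (poly μ).degree < x := by
    intro μ
    rw [Polynomial.degree_lt_iff_coeff_zero]
    intro m hm
    simp only [poly, Polynomial.finsetSum_coeff, Polynomial.coeff_C_mul_X_pow]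
    refine Finset.sum_eq_zero fun y _ => if_neg ?_
    have := y.2
    omega
  have hcoeff : ∀ μ (y : Fin x), (poly μ).coeff y = μ y := by
    intro μ y
    simp only [poly, Polynomial.finsetSum_coeff, Polynomial.coeff_C_mul_X_pow]
    rw [Finset.sum_eq_single y]
    · simp
    · intro y' _ hne
      rw [if_neg]
      intro h
      exact hne (Fin.ext h.symm)
    · simp
  refine ⟨fun μ z => (poly μ).eval (pt z), fun Z hZ hx μ μ' h => ?_⟩
  -- Polynomials of degree below `x` that agree at `x` distinct points are equal.
  have hc : (x : WithBot ℕ) ≤ Z.card := by exact_mod_cast hx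
  have := Polynomial.eq_of_degrees_lt_of_eval_index_eq Z (v := pt)
    (hpt.mono (by exact_mod_cast hZ)) ((hdeg μ).trans_le hc) ((hdeg μ').trans_le hc) h
  funext y
  rw [← hcoeff μ y, ← hcoeff μ' y, this]

/-- Messages embed into the field with `2 ^ α` elements, which has `L` distinct evaluation points;
its elements fit into packets as `α ≤ β`. -/
theorem exists_isErasureCode {α β x L : ℕ} (h0 : α ≠ 0) (hαβ : α ≤ β) (hL : L ≤ 2 ^ α) :
    ∃ enc : (Fin x → (Fin α → Bool)) → ℕ → (Fin β → Bool), IsErasureCode L enc := by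
  classical
  have : Fact (Nat.Prime 2) := ⟨Nat.prime_two⟩
  let F := GaloisField 2 α
  let _ : Fintype F := Fintype.ofFinite F
  have hF : Fintype.card F = 2 ^ α := by
    rw [← Nat.card_eq_fintype_card]
    exact GaloisField.card 2 α h0
  obtain ⟨enc, henc⟩ := exists_isErasureCode_field F x (hF.symm ▸ hL)
  obtain ⟨i⟩ : Nonempty ((Fin α → Bool) ↪ F) :=
    Function.Embedding.nonempty_of_card_le (by simp [hF])
  obtain ⟨j⟩ : Nonempty (F ↪ (Fin β → Bool)) :=
    Function.Embedding.nonempty_of_card_le (by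
      simpa [hF] using Nat.pow_le_pow_right (by norm_num) hαβ)
  refine ⟨fun μ z => j (enc (fun y => i (μ y)) z), fun Z hZ hx μ μ' h => ?_⟩
  have := henc Z hZ hx _ _ fun z hz => j.injective (h z hz)
  funext y
  exact i.injective (congrFun this y)

open Classical in
/-- Some message that agrees with all symbols received. -/
noncomputable def erasureDecode {M P : Type} [Nonempty M] {x : ℕ} (L : ℕ)
    (enc : (Fin x → M) → ℕ → P) (w : ℕ → Option P) : Fin x → M :=
  if h : ∃ μ, ∀ z < L, ∀ c, w z = some c → c = enc μ z then h.choose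
  else fun _ => Classical.arbitrary M

theorem IsErasureCode.erasureDecode_eq {M P : Type} [Nonempty M] {x L : ℕ}
    {enc : (Fin x → M) → ℕ → P} (henc : IsErasureCode L enc) {w : ℕ → Option P} {μ : Fin x → M}
    (hw : ∀ z < L, ∀ c, w z = some c → c = enc μ z) {Z : Finset ℕ} (hZ : Z ⊆ Finset.range L)
    (hx : x ≤ Z.card) (hsome : ∀ z ∈ Z, (w z).isSome) : erasureDecode L enc w = μ := by
  have h : ∃ μ, ∀ z < L, ∀ c, w z = some c → c = enc μ z := ⟨μ, hw⟩
  rw [erasureDecode, dif_pos h]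
  refine henc Z hZ hx _ _ fun z hz => ?_
  obtain ⟨c, hc⟩ := Option.isSome_iff_exists.1 (hsome z hz)
  have hz' := Finset.mem_range.1 (hZ hz)
  rw [← h.choose_spec z hz' c hc, ← hw z hz' c hc]

end ErasureCode

section History

variable {V M P : Type} [DecidableEq V] {k : ℕ} (σ : CodingSchedule V M P k) (G : SimpleGraph V)
  (s : V) (m : Fin k → M) (fault : ℕ → V → Bool)

theorem CodingSchedule.length_history (t : ℕ) (v : V) :
    (σ.history G s m fault t v).length = t := by
  induction t with
  | zero => rfl
  | succ t ih => simp [CodingSchedule.history, ih]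

theorem CodingSchedule.history_getElem? {r t : ℕ} (h : r < t) (v : V) :
    (σ.history G s m fault t v)[r]? = some (recv G
      (fun u => σ.send u r (initKnowledge s m u) (σ.history G s m fault r u)) (fault r) v) := by
  induction t with
  | zero => omega
  | succ t ih =>
    rw [CodingSchedule.history]
    rcases Nat.lt_succ_iff_lt_or_eq.1 h with hlt | rfl
    · rw [List.getElem?_append_left (by rwa [CodingSchedule.length_history]), ih hlt]
    · rw [List.getElem?_append_right (by rw [CodingSchedule.length_history])]
      simp [CodingSchedule.length_history]

end History

namespace FaultlessSchedule

variable {V κ M P : Type} [DecidableEq V] {G : SimpleGraph V} {s : V} {T₀ : ℕ}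
  (F : FaultlessSchedule G s κ T₀) {k x : ℕ} (e : Fin k ≃ κ × Fin x) (L : ℕ)
  [Nonempty M] (enc : (Fin x → M) → ℕ → P)

/-- What `v` believes to be the messages of the group `h`. -/
noncomputable def estimate (v : V) (h : κ) (init : Option (Fin k → M)) (hist : List (Option P)) :
    Fin x → M :=
  match init with
  | some m => fun y => m (e.symm (h, y))
  | none => erasureDecode L enc fun z => (hist[F.learn v h * L + z]?).join

/-- Every round of `F` becomes a block of `L` rounds, in which a sender broadcasts the codeword of
a group of `x` messages. -/
noncomputable def toCoding : CodingSchedule V M P k where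
  send u r init hist := (F.act (r / L) u).map fun h => enc (F.estimate e L enc u h init hist) (r % L)
  decode v init hist := fun i => F.estimate e L enc v (e i).1 init hist (e i).2

variable {F e L enc}

theorem estimate_source (m : Fin k → M) (h : κ) (hist : List (Option P)) :
    F.estimate e L enc s h (initKnowledge s m s) hist = fun y => m (e.symm (h, y)) := by
  simp [estimate, initKnowledge]

/-- Induction on the learning round: the parent already has the right group throughout the block, so
its `x` fault-free rounds deliver enough symbols. -/
theorem estimate_toCoding (henc : IsErasureCode L enc) {m : Fin k → M} {fault : ℕ → V → Bool}
    (hgood : ∀ g < T₀, ∀ u,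
      x ≤ ((Finset.range L).filter fun z => fault (g * L + z) u = false).card) :
    ∀ N v h, v ≠ s → F.learn v h < N → ∀ t, (F.learn v h + 1) * L ≤ t →
      F.estimate e L enc v h (initKnowledge s m v)
        ((F.toCoding e L enc).history G s m fault t v) = fun y => m (e.symm (h, y)) := by
  intro N
  induction N with
  | zero => simp
  | succ N ih =>
    intro v h hv hN t ht
    set σ := F.toCoding e L enc with hσ
    set g := F.learn v h with hg
    set u := F.parent v h with hu
    have hsend : ∀ z < L, ∀ w, σ.send w (g * L + z) (initKnowledge s m w)
        (σ.history G s m fault (g * L + z) w) =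
        (F.act g w).map fun h => enc (F.estimate e L enc w h (initKnowledge s m w)
          (σ.history G s m fault (g * L + z) w)) z := by
      intro z hz w
      have hmod : (g * L + z) % L = z := by
        rw [Nat.mul_comm, Nat.mul_add_mod, Nat.mod_eq_of_lt hz]
      simp only [hσ, toCoding, blockIndex_div hz, hmod]
    have hsend_u : ∀ z < L, σ.send u (g * L + z) (initKnowledge s m u)
        (σ.history G s m fault (g * L + z) u) =
        some (enc (fun y => m (e.symm (h, y))) z) := by
      intro z hz
      rw [hsend z hz, F.act_parent v h hv, Option.map_some]
      congr 2
      by_cases hs : u = s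
      · rw [hs, estimate_source]
      · have hlt : F.learn u h < g := (F.parent_knows v h hv).resolve_left hs
        exact ih u h hs (by omega) _ ((Nat.mul_le_mul_right _ hlt).trans (Nat.le_add_right _ _))
    have huniq : ∀ z < L, ∀ w, G.Adj v w → σ.send w (g * L + z) (initKnowledge s m w)
        (σ.history G s m fault (g * L + z) w) ≠ none → w = u := by
      intro z hz w hw hne
      refine F.eq_parent v h hv w hw fun hc => hne ?_
      rw [hsend z hz, hc, Option.map_none]
    have hlook : ∀ z < L, ((σ.history G s m fault t v)[g * L + z]?).join =
        recv G (fun u => σ.send u (g * L + z) (initKnowledge s m u)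
          (σ.history G s m fault (g * L + z) u)) (fault (g * L + z)) v := by
      intro z hz
      rw [σ.history_getElem? G s m fault (by rw [Nat.succ_mul] at ht; omega), Option.join_some]
    have hinit : initKnowledge s m v = none := if_neg hv
    rw [hinit, estimate]
    refine henc.erasureDecode_eq ?_ (Finset.filter_subset _ _) (hgood g (F.learn_lt v h hv) u) ?_
    -- Only the parent can be heard in this block, so every received symbol belongs to the true
    -- codeword.
    · intro z hz c hc
      rw [hlook z hz, recv_eq_some_iff] at hc
      obtain ⟨-, w, hw, hwc, -, -⟩ := hc
      beta_reduce at hwc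
      obtain rfl := huniq z hz w hw (by rw [hwc]; simp)
      rw [hsend_u z hz] at hwc
      exact (Option.some.inj hwc).symm
    · intro z hz
      rw [Finset.mem_filter, Finset.mem_range] at hz
      rw [hlook z hz.1, Option.isSome_iff_exists]
      refine ⟨enc (fun y => m (e.symm (h, y))) z, recv_eq_some_iff.2 ⟨?_, u,
        F.adj_parent v h hv, hsend_u z hz.1, hz.2, huniq z hz.1⟩⟩
      beta_reduce
      rw [hsend z hz.1, F.act_self v h hv, Option.map_none]

theorem codingFeasible [Fintype V] (F : FaultlessSchedule G s κ T₀) {k x L : ℕ}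
    (e : Fin k ≃ κ × Fin x) {p a b : ℝ} (hp0 : 0 ≤ p) (hp1 : p ≤ 1) (hab : a ≤ b)
    (hk : (T₀ * Fintype.card V : ℝ) * (2 ^ x * ((1 + p) / 2) ^ L) ≤ 1 / k)
    (hα : bitLength a (Fintype.card V) k ≠ 0) (hL : L ≤ 2 ^ bitLength a (Fintype.card V) k) :
    CodingFeasible p a b G s k (T₀ * L) := by
  have hαβ : bitLength a (Fintype.card V) k ≤ bitLength b (Fintype.card V) k := by
    refine Nat.ceil_mono (mul_le_mul_of_nonneg_right hab ?_)
    rw [← Nat.cast_mul]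
    exact div_nonneg (Real.log_natCast_nonneg _) (Real.log_nonneg (by norm_num))
  obtain ⟨enc, henc⟩ := exists_isErasureCode (x := x) hα hαβ hL
  refine ⟨F.toCoding e L enc, fun m =>
    le_trans (by linarith) (faultProb_of_goodFaults hp0 hp1 (x := x) ?_)⟩
  intro ω hω v
  funext i
  by_cases hv : v = s
  · subst hv
    simp [toCoding, estimate_source]
  · have := F.learn_lt v (e i).1 hv
    simp only [toCoding]
    rw [← toCoding, estimate_toCoding (F := F) (e := e) henc hω (F.learn v (e i).1 + 1) v (e i).1 hv
      (Nat.lt_succ_self _) (T₀ * L) (Nat.mul_le_mul_right _ this)]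
    simp

end FaultlessSchedule

open Filter

/-! ### Achievable throughput -/

section Throughput

/-- Since throughput is a limsup, infinitely many `k` suffice; they can be chosen in the form that
suits the construction. -/
theorem ofReal_le_throughput {feasible : ℕ → ℕ → Prop} {D : ℝ} (hD : 0 < D)
    (h : ∃ᶠ k in atTop, ∃ T : ℕ, feasible k T ∧ (T : ℝ) ≤ D * k) :
    ENNReal.ofReal (1 / D) ≤ throughput feasible := by
  refine le_limsup_of_frequently_le ?_
  refine (h.and_eventually (eventually_gt_atTop 0)).mono fun k hk => ?_
  obtain ⟨⟨T, hT, hle⟩, hpos⟩ := hk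
  refine le_trans ?_ (ENNReal.div_le_div_left (iInf₂_le T hT) _)
  rw [ENNReal.le_div_iff_mul_le (Or.inr (by positivity)) (Or.inl (by simp)),
    ← ENNReal.ofReal_natCast, ← ENNReal.ofReal_natCast, ← ENNReal.ofReal_mul (by positivity)]
  apply ENNReal.ofReal_le_ofReal
  rw [one_div, inv_mul_le_iff₀ hD]
  exact hle

theorem throughput_le_ofReal {feasible : ℕ → ℕ → Prop} {D : ℝ} (hD : 0 < D)
    (h : ∀ᶠ k : ℕ in atTop, ∀ T : ℕ, feasible k T → D * k ≤ T) :
    throughput feasible ≤ ENNReal.ofReal (1 / D) := by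
  refine limsup_le_of_le (h := h.mono fun k hk => ENNReal.div_le_of_le_mul ?_)
  calc (k : ℝ≥0∞) = ENNReal.ofReal (1 / D) * ENNReal.ofReal (D * k) := by
        rw [← ENNReal.ofReal_mul (by positivity), ← mul_assoc, one_div,
          inv_mul_cancel₀ hD.ne', one_mul, ENNReal.ofReal_natCast]
    _ ≤ _ := by
        gcongr
        refine le_iInf₂ fun T hT => ?_
        rw [← ENNReal.ofReal_natCast]
        exact ENNReal.ofReal_le_ofReal (hk T hT)

end Throughput

section LowerBound

open Equiv

theorem eventually_const_mul_pow_le_two_pow (c : ℝ) (d : ℕ) :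
    ∀ᶠ x : ℕ in atTop, c * (x : ℝ) ^ d ≤ 2 ^ x := by
  have h := (tendsto_pow_const_div_const_pow_of_one_lt d (r := (2 : ℝ)) (by norm_num)).const_mul c
  rw [mul_zero] at h
  filter_upwards [h.eventually (ge_mem_nhds zero_lt_one)] with x hx
  rwa [← mul_div_assoc, div_le_one (by positivity)] at hx

/-- With `k` the cardinality in the exponent, `C x ≤ x² ≤ (x ^ r) ^ a ≤ (n k) ^ a`. Taking `x ^ r`
batches thus makes the messages long enough for a Reed–Solomon code of length `C x`. -/
theorem le_two_pow_bitLength {a : ℝ} (ha : 0 < a) {n r x C : ℕ} (hn : 0 < n) (hr : 2 ≤ r * a)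
    (hx : 0 < x) (hC : C ≤ x) :
    C * x ≤ 2 ^ bitLength a n (Fintype.card ((Fin (x ^ r) × Perm (Fin n)) × Fin x)) := by
  have hx1 : (1 : ℝ) ≤ x := by exact_mod_cast hx
  have hn1 : (1 : ℝ) ≤ n := by exact_mod_cast hn
  have hf1 : (1 : ℝ) ≤ n.factorial := by exact_mod_cast n.factorial_pos
  have hk : ((Fintype.card ((Fin (x ^ r) × Perm (Fin n)) × Fin x) : ℕ) : ℝ) =
      (x : ℝ) ^ r * n.factorial * x := by
    simp [Fintype.card_perm]
  have hge : (x : ℝ) ^ r ≤ n * ((x : ℝ) ^ r * n.factorial * x) := by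
    have h0 : 0 < (x : ℝ) ^ r := by positivity
    have h1 : 1 ≤ n * ((n.factorial : ℝ) * x) :=
      one_le_mul_of_one_le_of_one_le hn1 (one_le_mul_of_one_le_of_one_le hf1 hx1)
    nlinarith
  have hpos : 0 < (n : ℝ) * ((x : ℝ) ^ r * n.factorial * x) := by positivity
  have key : ((C * x : ℕ) : ℝ) ≤
      2 ^ bitLength a n (Fintype.card ((Fin (x ^ r) × Perm (Fin n)) × Fin x)) := by
    calc ((C * x : ℕ) : ℝ) ≤ (x : ℝ) ^ (2 : ℝ) := by
          rw [Real.rpow_two, sq]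
          push_cast
          gcongr
      _ ≤ (x : ℝ) ^ (r * a) := Real.rpow_le_rpow_of_exponent_le hx1 hr
      _ = ((x : ℝ) ^ r) ^ a := by
          rw [Real.rpow_mul (by positivity), Real.rpow_natCast]
      _ ≤ (n * ((x : ℝ) ^ r * n.factorial * x)) ^ a :=
          Real.rpow_le_rpow (by positivity) hge ha.le
      _ = (2 : ℝ) ^ (a * Real.logb 2 (n * ((x : ℝ) ^ r * n.factorial * x))) := by
          rw [mul_comm a, Real.rpow_mul (by norm_num),
            Real.rpow_logb (by norm_num) (by norm_num) hpos]
      _ ≤ _ := by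
          rw [← Real.rpow_natCast 2]
          refine Real.rpow_le_rpow_of_exponent_le (by norm_num) ?_
          unfold bitLength
          rw [hk]
          exact Nat.le_ceil _
  exact_mod_cast key

/-- The `x ^ r` batches outweigh the `n` extra phases of the pipeline once `x ≥ n`. The failure
bound is `2 ^ (-x)` times a polynomial in `x`, hence eventually below `1 / k`, as `k` is itself
polynomial in `x`. -/
theorem frequently_feasible {p a b : ℝ} (hp0 : 0 ≤ p) (hp1 : p < 1) (ha : 0 < a) (hab : a ≤ b)
    {C : ℕ} (hC : ((1 + p) / 2) ^ C ≤ 1 / 4) (hC2 : 2 ≤ C) {n : ℕ} {G : SimpleGraph (Fin n)}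
    (hG : G.Connected) (s : Fin n) :
    ∃ᶠ k : ℕ in atTop, ∃ T : ℕ, (RoutingFeasible p G s k T ∧ CodingFeasible p a b G s k T) ∧
      (T : ℝ) ≤ 6 * C * (1 + Real.log n) * k := by
  have hn : 0 < n := s.pos
  obtain ⟨r, hr⟩ := exists_nat_ge (2 / a)
  rw [div_le_iff₀ ha] at hr
  set H := Nat.card (PhaseRound n) with hH
  let k : ℕ → ℕ := fun x => Fintype.card ((Fin (x ^ r) × Perm (Fin n)) × Fin x)
  have hk : ∀ x, (k x : ℝ) = (x : ℝ) ^ r * n.factorial * x := fun x => by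
    simp [k, Fintype.card_perm]
  have hkx : ∀ x, 0 < x → x ≤ k x := by
    intro x hx
    have : k x = x ^ r * n.factorial * x := by simp [k, Fintype.card_perm]
    rw [this]
    exact Nat.le_mul_of_pos_left _ (Nat.mul_pos (pow_pos hx r) n.factorial_pos)
  have hktop : Tendsto k atTop atTop :=
    tendsto_atTop_mono' atTop ((eventually_gt_atTop 0).mono hkx) tendsto_id
  refine hktop.frequently (Eventually.frequently ?_)
  filter_upwards [eventually_ge_atTop (max 1 (max n C)),
    eventually_const_mul_pow_le_two_pow (6 * H * n * n.factorial) (2 * r + 1)] with x hx hlarge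
  have hx1 : 1 ≤ x := le_trans (le_max_left _ _) hx
  have hxn : n ≤ x := le_trans (le_trans (le_max_left _ _) (le_max_right _ _)) hx
  have hxC : C ≤ x := le_trans (le_trans (le_max_right _ _) (le_max_right _ _)) hx
  have hr0 : r ≠ 0 := by
    rintro rfl
    norm_num at hr
  have hsum : ((x : ℝ) ^ r + n) ≤ 2 * (x : ℝ) ^ r := by
    have h1 : n ≤ x ^ r := hxn.trans (Nat.le_self_pow hr0 x)
    have h2 : (n : ℝ) ≤ (x : ℝ) ^ r := by exact_mod_cast h1
    linarith
  obtain ⟨F⟩ := exists_faultlessSchedule hG s (x ^ r)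
  let e : Fin (k x) ≃ (Fin (x ^ r) × Perm (Fin n)) × Fin x := (Fintype.equivFin _).symm
  have hkpos : (0 : ℝ) < k x := by exact_mod_cast lt_of_lt_of_le hx1 (hkx x hx1)
  have hT : (((3 * (x ^ r + n) * H : ℕ)) : ℝ) ≤ 6 * H * (x : ℝ) ^ r := by
    push_cast
    nlinarith [Nat.cast_nonneg (α := ℝ) H]
  have hfail : (((3 * (x ^ r + n) * H : ℕ)) * Fintype.card (Fin n) : ℝ) *
      (2 ^ x * ((1 + p) / 2) ^ (C * x)) ≤ 1 / k x := by
    have h1 : (2 : ℝ) ^ x * ((1 + p) / 2) ^ (C * x) ≤ (1 / 2) ^ x := by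
      rw [pow_mul, ← mul_pow]
      refine pow_le_pow_left₀ (by positivity) ?_ x
      linarith
    rw [Fintype.card_fin, le_div_iff₀ hkpos]
    calc _ ≤ (6 * H * (x : ℝ) ^ r * n) * (1 / 2) ^ x * k x := by gcongr
      _ = (6 * H * n * n.factorial * (x : ℝ) ^ (2 * r + 1)) * (1 / 2) ^ x := by
          rw [hk]; ring
      _ ≤ 2 ^ x * (1 / 2) ^ x := by gcongr
      _ = 1 := by rw [← mul_pow]; norm_num
  have hL := le_two_pow_bitLength ha hn hr hx1 hxC
  refine ⟨3 * (x ^ r + n) * H * (C * x), ⟨F.routingFeasible e hp0 hp1.le hfail,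
    F.codingFeasible e hp0 hp1.le hab hfail ?_ ?_⟩, ?_⟩
  · rw [Fintype.card_fin]
    -- Messages of length 0 would force `C x ≤ 1`.
    intro h0
    rw [h0, pow_zero] at hL
    have : 2 * 1 ≤ C * x := Nat.mul_le_mul hC2 hx1
    omega
  · rwa [Fintype.card_fin]
  · calc (((3 * (x ^ r + n) * H * (C * x) : ℕ)) : ℝ)
        = ((3 * (x ^ r + n) * H : ℕ) : ℝ) * (C * x) := by push_cast; ring
      _ ≤ 6 * (n.factorial * (1 + Real.log n)) * (x : ℝ) ^ r * (C * x) := by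
          refine mul_le_mul_of_nonneg_right (hT.trans ?_) (by positivity)
          gcongr
          exact card_phaseRound_le n
      _ = _ := by rw [hk]; ring

end LowerBound

/-- Whatever the set `S` of broadcasting nodes is, at most a fraction `δ` of the nodes of `B` have
exactly one neighbour in `S`. -/
structure IsBottleneck {V : Type} (G : SimpleGraph V) (s : V) (B : Finset V) (δ : ℝ) : Prop where
  source_notMem : s ∉ B
  nonempty : B.Nonempty
  card_le : ∀ (S : Set V) (R : Finset V), R ⊆ B → (∀ v ∈ R, ∃! u, G.Adj v u ∧ u ∈ S) →
    (R.card : ℝ) ≤ δ * B.card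

/-! ### Throughput bounds from a bottleneck -/

section Receptions

variable {V P : Type}

theorem existsUnique_of_recv_ne_none {G : SimpleGraph V} {act : V → Option P} {fault : V → Bool}
    {v : V} (h : recv G act fault v ≠ none) : ∃! u, G.Adj v u ∧ u ∈ {u | act u ≠ none} := by
  obtain ⟨x, hx⟩ := Option.ne_none_iff_exists'.1 h
  obtain ⟨-, u, hu, hux, -, huniq⟩ := recv_eq_some_iff.1 hx
  refine ⟨u, ⟨hu, ?_⟩, fun w hw => huniq w hw.1 hw.2⟩
  change act u ≠ none
  simp [hux]

theorem IsBottleneck.sum_recv_le {G : SimpleGraph V} {s : V} {B : Finset V} {δ : ℝ}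
    (hB : IsBottleneck G s B δ) (act : V → Option P) (fault : V → Bool) :
    ((∑ v ∈ B, (recv G act fault v).toFinset.card : ℕ) : ℝ) ≤ δ * B.card := by
  classical
  refine le_trans ?_ (hB.card_le {u | act u ≠ none}
    (B.filter fun v => recv G act fault v ≠ none) (Finset.filter_subset _ _)
    fun v hv => existsUnique_of_recv_ne_none (Finset.mem_filter.1 hv).2)
  rw [Finset.card_filter]
  refine Nat.cast_le.2 (Finset.sum_le_sum fun v _ => ?_)
  cases recv G act fault v <;> simp

end Receptions

section Routing

variable {V : Type} [DecidableEq V] {G : SimpleGraph V} {s : V} {B : Finset V} {δ : ℝ}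

theorem IsBottleneck.sum_known_le (hB : IsBottleneck G s B δ) {k : ℕ}
    (σ : AdaptiveRoutingSchedule V k) (fault : ℕ → V → Bool) (t : ℕ) :
    ((∑ v ∈ B, (σ.known G s fault t v).card : ℕ) : ℝ) ≤ t * (δ * B.card) := by
  induction t with
  | zero =>
    have : ∑ v ∈ B, (σ.known G s fault 0 v).card = 0 := Finset.sum_eq_zero fun v hv => by
      have : v ≠ s := fun h => hB.source_notMem (h ▸ hv)
      simp [AdaptiveRoutingSchedule.known, this]
    simp [this]
  | succ t ih =>
    have h1 := hB.sum_recv_le (σ.act t (σ.known G s fault t)) (fault t)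
    have h2 : ∑ v ∈ B, (σ.known G s fault (t + 1) v).card ≤ ∑ v ∈ B, (σ.known G s fault t v).card +
        ∑ v ∈ B, (recv G (σ.act t (σ.known G s fault t)) (fault t) v).toFinset.card := by
      rw [← Finset.sum_add_distrib]
      exact Finset.sum_le_sum fun v _ => Finset.card_union_le _ _
    have h3 : ((∑ v ∈ B, (σ.known G s fault (t + 1) v).card : ℕ) : ℝ) ≤ _ := Nat.cast_le.2 h2
    push_cast at *
    linarith

theorem one_sub_one_div_ge_half {k : ℕ} (hk : 2 ≤ k) : (1 : ℝ) / 2 ≤ 1 - 1 / k := by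
  have h1 : (2 : ℝ) ≤ k := by exact_mod_cast hk
  have h2 : (1 : ℝ) / k ≤ 1 / 2 := one_div_le_one_div_of_le (by norm_num) h1
  linarith

/-- On one successful fault pattern, `B` needs `k |B|` receptions and gets at most `δ |B|` per
round. -/
theorem IsBottleneck.le_of_routingFeasible [Fintype V] (hB : IsBottleneck G s B δ) {p : ℝ}
    {k T : ℕ} (hk : 2 ≤ k) (h : RoutingFeasible p G s k T) : (k : ℝ) ≤ δ * T := by
  obtain ⟨σ, hσ⟩ := h
  obtain ⟨ω, hω⟩ := exists_of_faultProb_pos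
    (lt_of_lt_of_le (by norm_num) ((one_sub_one_div_ge_half hk).trans hσ))
  have h1 := hB.sum_known_le σ (faultAt ω) T
  simp only [hω, Finset.card_univ, Fintype.card_fin, Finset.sum_const, smul_eq_mul] at h1
  push_cast at h1
  have h2 : (0 : ℝ) < B.card := by exact_mod_cast hB.nonempty.card_pos
  nlinarith

theorem IsBottleneck.routingThroughput_le [Fintype V] (hB : IsBottleneck G s B δ) (hδ : 0 < δ)
    (p : ℝ) : routingThroughput p G s ≤ ENNReal.ofReal δ := by
  unfold routingThroughput
  have := throughput_le_ofReal (feasible := RoutingFeasible p G s) (D := 1 / δ) (by positivity) ?_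
  · simpa using this
  · filter_upwards [eventually_ge_atTop 2] with k hk T hT
    rw [one_div, inv_mul_le_iff₀ hδ]
    exact hB.le_of_routingFeasible hk hT

end Routing

section Coding

/-- There are at most `2 ^ T * |P| ^ R` reception patterns of `T` rounds with at most `R` packets. -/
theorem card_receptions_le {P : Type} [Fintype P] [Nonempty P] (T R : ℕ)
    (W : Finset (Fin T → Option P)) (hW : ∀ w ∈ W, ∑ t, (w t).toFinset.card ≤ R) :
    W.card ≤ 2 ^ T * Fintype.card P ^ R := by
  classical
  have hq : (1 : ℝ) ≤ Fintype.card P := by exact_mod_cast Fintype.card_pos (α := P)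
  have hq' : ((Fintype.card P : ℝ))⁻¹ ≤ 1 := inv_le_one_of_one_le₀ hq
  -- Each received packet is weighted by `1 / |P|`, so a round has total weight `1 + |P| / |P| = 2`.
  have hsum : ∑ o : Option P, ((Fintype.card P : ℝ)⁻¹) ^ o.toFinset.card = 2 := by
    rw [Fintype.sum_option]
    simp
    norm_num
  have key : (W.card : ℝ) * ((Fintype.card P : ℝ)⁻¹) ^ R ≤ 2 ^ T := by
    calc (W.card : ℝ) * ((Fintype.card P : ℝ)⁻¹) ^ R
        = ∑ w ∈ W, ((Fintype.card P : ℝ)⁻¹) ^ R := by simp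
      _ ≤ ∑ w ∈ W, ∏ t, ((Fintype.card P : ℝ)⁻¹) ^ (w t).toFinset.card := by
          refine Finset.sum_le_sum fun w hw => ?_
          rw [Finset.prod_pow_eq_pow_sum]
          exact pow_le_pow_of_le_one (by positivity) hq' (hW w hw)
      _ ≤ ∑ w : Fin T → Option P, ∏ t, ((Fintype.card P : ℝ)⁻¹) ^ (w t).toFinset.card :=
          Finset.sum_le_sum_of_subset_of_nonneg (Finset.subset_univ W) fun _ _ _ => by positivity
      _ = 2 ^ T := by rw [← hsum, Fintype.sum_pow]
  rw [inv_pow, ← div_eq_mul_inv, div_le_iff₀ (by positivity)] at key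
  exact_mod_cast key

variable {V : Type} [DecidableEq V] {G : SimpleGraph V} {s : V} {B : Finset V} {δ : ℝ}

/-- What `v` receives in round `r`. -/
noncomputable def CodingSchedule.reception {M P : Type} {k : ℕ} (σ : CodingSchedule V M P k)
    (G : SimpleGraph V) (s : V) (m : Fin k → M) (fault : ℕ → V → Bool) (r : ℕ) (v : V) : Option P :=
  recv G (fun u => σ.send u r (initKnowledge s m u) (σ.history G s m fault r u)) (fault r) v

theorem CodingSchedule.history_eq_of_reception_eq {M P : Type} {k : ℕ}
    {σ : CodingSchedule V M P k} {m m' : Fin k → M} {fault : ℕ → V → Bool} {v : V} {T : ℕ}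
    (h : ∀ r < T, σ.reception G s m fault r v = σ.reception G s m' fault r v) :
    σ.history G s m fault T v = σ.history G s m' fault T v := by
  refine List.ext_getElem? fun r => ?_
  by_cases hr : r < T
  · rw [σ.history_getElem? G s m fault hr, σ.history_getElem? G s m' fault hr]
    exact congrArg some (h r hr)
  · rw [List.getElem?_eq_none, List.getElem?_eq_none] <;>
      rw [CodingSchedule.length_history] <;> omega

/-- Averaging over fault patterns. Counting needs one pattern that works for many messages
simultaneously. -/
theorem exists_faultPattern_many [Fintype V] {p : ℝ} (hp0 : 0 ≤ p) (hp1 : p ≤ 1) {T : ℕ}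
    {ι : Type} [Fintype ι] (E : ι → (Fin T → V → Bool) → Prop) {c : ℝ}
    (h : ∀ i, c ≤ faultProb p T (E i)) :
    ∃ (ω : Fin T → V → Bool) (S : Finset ι), (∀ i ∈ S, E i ω) ∧ c * Fintype.card ι ≤ S.card := by
  classical
  obtain ⟨ω₀, hω₀⟩ := Finite.exists_max fun ω : Fin T → V → Bool =>
    (Finset.univ.filter fun i => E i ω).card
  refine ⟨ω₀, Finset.univ.filter fun i => E i ω₀, fun i hi => (Finset.mem_filter.1 hi).2, ?_⟩
  calc c * Fintype.card ι = ∑ _i : ι, c := by simp [mul_comm]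
    _ ≤ ∑ i, faultProb p T (E i) := Finset.sum_le_sum fun i _ => h i
    _ = ∑ ω, faultWeight p T ω * ((Finset.univ.filter fun i => E i ω).card : ℝ) := by
        simp_rw [faultProb_eq]
        rw [Finset.sum_comm]
        refine Finset.sum_congr rfl fun ω _ => ?_
        rw [← Finset.sum_filter, Finset.sum_const, nsmul_eq_mul, mul_comm]
    _ ≤ ∑ ω, faultWeight p T ω * ((Finset.univ.filter fun i => E i ω₀).card : ℝ) := by
        refine Finset.sum_le_sum fun ω _ => ?_
        exact mul_le_mul_of_nonneg_left (by exact_mod_cast hω₀ ω) (faultWeight_nonneg hp0 hp1 ω)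
    _ = _ := by rw [← Finset.sum_mul, sum_faultWeight, one_mul]

theorem IsBottleneck.exists_few_receptions (hB : IsBottleneck G s B δ) (hδ : 0 ≤ δ) {M P : Type}
    {k : ℕ} (σ : CodingSchedule V M P k) (m : Fin k → M) (fault : ℕ → V → Bool) (T : ℕ) :
    ∃ v ∈ B, ∑ t : Fin T, (σ.reception G s m fault t v).toFinset.card ≤ ⌊δ * T⌋₊ := by
  by_contra! hc
  have hpos : (0 : ℝ) < B.card := by exact_mod_cast hB.nonempty.card_pos
  have h1 : ∀ v ∈ B, δ * T < ((∑ t : Fin T, (σ.reception G s m fault t v).toFinset.card : ℕ) : ℝ) :=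
    fun v hv => (Nat.floor_lt (by positivity)).1 (hc v hv)
  have h2 : ((∑ v ∈ B, ∑ t : Fin T, (σ.reception G s m fault t v).toFinset.card : ℕ) : ℝ) ≤
      T * (δ * B.card) := by
    rw [Finset.sum_comm]
    calc _ = ∑ t : Fin T, ((∑ v ∈ B, (σ.reception G s m fault t v).toFinset.card : ℕ) : ℝ) := by
          push_cast; rfl
      _ ≤ ∑ _t : Fin T, δ * B.card := Finset.sum_le_sum fun t _ => hB.sum_recv_le _ _
      _ = _ := by simp
  have h3 := Finset.sum_lt_sum_of_nonempty hB.nonempty h1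
  rw [Finset.sum_const, nsmul_eq_mul] at h3
  push_cast at h2 h3
  nlinarith

/-- Under a fixed fault pattern that serves half of the message vectors, such a vector is determined
by a node of `B` with few receptions and by what it receives: this node is not the source and
decodes from nothing else. -/
theorem IsBottleneck.card_messages_le [Fintype V] (hB : IsBottleneck G s B δ) (hδ : 0 ≤ δ)
    {M P : Type} [Fintype M] [Fintype P] [Nonempty P] {k T : ℕ} {p : ℝ} (hp0 : 0 ≤ p)
    (hp1 : p ≤ 1) (hk : 2 ≤ k) (σ : CodingSchedule V M P k)
    (hσ : ∀ m : Fin k → M, 1 - 1 / (k : ℝ) ≤ faultProb p T fun ω =>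
      ∀ v, σ.decode v (initKnowledge s m v) (σ.history G s m (faultAt ω) T v) = m) :
    Fintype.card M ^ k ≤ 2 * (Fintype.card V * (2 ^ T * Fintype.card P ^ ⌊δ * T⌋₊)) := by
  classical
  obtain ⟨ω, S, hS, hcard⟩ := exists_faultPattern_many hp0 hp1 _
    fun m => (one_sub_one_div_ge_half hk).trans (hσ m)
  choose node hnode hfew using fun m => hB.exists_few_receptions hδ σ m (faultAt ω) T
  let W : Finset (Fin T → Option P) :=
    Finset.univ.filter fun w => ∑ t, (w t).toFinset.card ≤ ⌊δ * T⌋₊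
  have hle : S.card ≤ ((Finset.univ : Finset V) ×ˢ W).card := by
    refine Finset.card_le_card_of_injOn
      (fun m => (node m, fun t => σ.reception G s m (faultAt ω) t (node m))) ?_ ?_
    · intro m _
      simp only [Finset.coe_product, Set.mem_prod, Finset.mem_coe, Finset.mem_univ, true_and, W,
        Finset.mem_filter]
      exact hfew m
    · intro m hm m' hm' heq
      rw [Prod.mk.injEq] at heq
      obtain ⟨hv, hrec⟩ := heq
      have hne : ∀ m, initKnowledge s m (node m) = none := fun m =>
        if_neg fun hs : node m = s => hB.source_notMem (hs ▸ hnode m)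
      have h1 := hS m hm (node m)
      have h2 := hS m' hm' (node m')
      rw [hne] at h1 h2
      rw [← h1, ← h2, ← hv]
      congr 1
      refine CodingSchedule.history_eq_of_reception_eq fun r hr => ?_
      have := congrFun hrec ⟨r, hr⟩
      simpa only [← hv] using this
  rw [Finset.card_product, Finset.card_univ] at hle
  have hW := card_receptions_le T ⌊δ * T⌋₊ W fun w hw => (Finset.mem_filter.1 hw).2
  have h3 : S.card ≤ Fintype.card V * (2 ^ T * Fintype.card P ^ ⌊δ * T⌋₊) :=
    hle.trans (Nat.mul_le_mul_left _ hW)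
  have h4 : (Fintype.card (Fin k → M) : ℝ) ≤ 2 * S.card := by linarith
  rw [Fintype.card_fun, Fintype.card_fin] at h4
  have h5 : Fintype.card M ^ k ≤ 2 * S.card := by exact_mod_cast h4
  omega

theorem IsBottleneck.bits_le [Fintype V] (hB : IsBottleneck G s B δ) (hδ : 0 ≤ δ)
    {p a b : ℝ} (hp0 : 0 ≤ p) (hp1 : p ≤ 1) {k T : ℕ} (hk : 2 ≤ k)
    (h : CodingFeasible p a b G s k T) :
    (bitLength a (Fintype.card V) k * k : ℝ) ≤
      1 + Fintype.card V + T + bitLength b (Fintype.card V) k * (δ * T) := by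
  obtain ⟨σ, hσ⟩ := h
  have h1 := hB.card_messages_le hδ hp0 hp1 hk σ hσ
  simp only [Fintype.card_fun, Fintype.card_fin, Fintype.card_bool, ← pow_mul] at h1
  have h2 : 2 ^ (bitLength a (Fintype.card V) k * k) ≤
      2 ^ (1 + (Fintype.card V + (T + bitLength b (Fintype.card V) k * ⌊δ * T⌋₊))) := by
    -- The crude `|V| ≤ 2 ^ |V|` is harmless, since the graph stays fixed as `k` grows.
    rw [pow_add, pow_add 2 (Fintype.card V), pow_add, pow_one]
    refine h1.trans ?_
    gcongr
    exact Nat.lt_two_pow_self.le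
  have h3 := (Nat.pow_le_pow_iff_right (by norm_num)).1 h2
  have h4 : ((bitLength a (Fintype.card V) k * k : ℕ) : ℝ) ≤ _ := Nat.cast_le.2 h3
  have h5 := Nat.floor_le (show 0 ≤ δ * T by positivity)
  push_cast at h4
  nlinarith [Nat.cast_nonneg (α := ℝ) (bitLength b (Fintype.card V) k)]

/-- For large `k`, half of the `a Λ k` message bits absorbs `1 + |V|`. The `T` bits of the silence
pattern are at most `b Λ δ T` and the packets carry at most `2 b Λ δ T`, whence the factor `6 = 2 *
3`. -/
theorem IsBottleneck.codingThroughput_le [Fintype V] (hB : IsBottleneck G s B δ) (hδ : 0 < δ)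
    {p a b : ℝ} (hp0 : 0 ≤ p) (hp1 : p ≤ 1) (ha : 0 < a) (hb : 0 < b) :
    codingThroughput p a b G s ≤ ENNReal.ofReal (6 * b * δ / a) := by
  unfold codingThroughput
  have hD : 0 < a / (6 * b * δ) := by positivity
  have hV : 0 < Fintype.card V := Fintype.card_pos_iff.2 ⟨s⟩
  have := throughput_le_ofReal (feasible := CodingFeasible p a b G s) hD ?_
  · simpa using this
  have hlog : Tendsto (fun k : ℕ => Real.logb 2 ((Fintype.card V : ℝ) * (k : ℝ))) atTop atTop :=
    (Real.tendsto_logb_atTop (by norm_num)).comp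
      (tendsto_natCast_atTop_atTop.const_mul_atTop (by exact_mod_cast hV))
  filter_upwards [eventually_ge_atTop 2, hlog.eventually_ge_atTop 1,
    hlog.eventually_ge_atTop (1 / b), hlog.eventually_ge_atTop (1 / (b * δ)),
    tendsto_natCast_atTop_atTop.eventually_ge_atTop (2 * (1 + Fintype.card V : ℝ) / a)]
    with k hk hl1 hlb hlδ hkV T hT
  have h := hB.bits_le hδ.le hp0 hp1 hk hT
  set Λ := Real.logb 2 ((Fintype.card V : ℝ) * (k : ℝ)) with hΛ
  have hα : a * Λ ≤ bitLength a (Fintype.card V) k := Nat.le_ceil _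
  have hβ : (bitLength b (Fintype.card V) k : ℝ) ≤ b * Λ + 1 :=
    (Nat.ceil_lt_add_one (by positivity)).le
  rw [div_le_iff₀ hb] at hlb
  rw [div_le_iff₀ (by positivity)] at hlδ
  rw [div_le_iff₀ ha] at hkV
  have hT0 : (0 : ℝ) ≤ T := Nat.cast_nonneg T
  have hk0 : (0 : ℝ) ≤ k := Nat.cast_nonneg k
  have hΛ0 : 0 < Λ := by linarith
  have e1 : a * Λ * k ≤ bitLength a (Fintype.card V) k * k := by gcongr
  have e2 : bitLength b (Fintype.card V) k * (δ * T) ≤ 2 * (b * Λ) * (δ * T) := by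
    gcongr
    linarith
  have e3 : (T : ℝ) ≤ Λ * (b * δ) * T := le_mul_of_one_le_left hT0 hlδ
  have e4 : (1 + Fintype.card V : ℝ) ≤ Λ * (a * k / 2) := by
    have : 0 ≤ a * k / 2 := by positivity
    nlinarith
  have e5 : Λ * (a * k / 2) ≤ Λ * (3 * b * δ * T) := by nlinarith
  have e6 := le_of_mul_le_mul_left e5 hΛ0
  rw [div_mul_eq_mul_div, div_le_iff₀ (by positivity)]
  linarith

end Coding

/-! ### Isolation under pairwise independent hashing -/

section AffineHash

variable {F : Type} [Field F] [Fintype F] [DecidableEq F]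

/-- The number of `x ∈ S` that the map `x ↦ α x + β` sends to `W`. -/
def hits (W S : Finset F) (h : F × F) : ℕ := (S.filter fun x => h.1 * x + h.2 ∈ W).card

theorem card_affine_mem (W : Finset F) (x : F) :
    (Finset.univ.filter fun h : F × F => h.1 * x + h.2 ∈ W).card = Fintype.card F * W.card := by
  rw [← Finset.card_univ, ← Finset.card_product]
  refine Finset.card_bij' (fun h _ => (h.1, h.1 * x + h.2)) (fun h _ => (h.1, h.2 - h.1 * x))
    ?_ ?_ ?_ ?_ <;> simp

/-- Pairwise independence: an affine map is determined by its values at two points. -/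
theorem card_affine_mem_mem_le (W : Finset F) {x y : F} (hxy : x ≠ y) :
    (Finset.univ.filter fun h : F × F => h.1 * x + h.2 ∈ W ∧ h.1 * y + h.2 ∈ W).card ≤
      W.card ^ 2 := by
  rw [sq, ← Finset.card_product]
  refine Finset.card_le_card_of_injOn (fun h => (h.1 * x + h.2, h.1 * y + h.2)) ?_ ?_
  · intro h hh
    simpa using hh
  · rintro ⟨α, β⟩ - ⟨α', β'⟩ - h
    simp only [Prod.mk.injEq] at h ⊢
    obtain ⟨h1, h2⟩ := h
    have h3 : (α - α') * (x - y) = 0 := by linear_combination h1 - h2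
    have h4 : α = α' := by
      rcases mul_eq_zero.1 h3 with h | h
      · exact sub_eq_zero.1 h
      · exact absurd (sub_eq_zero.1 h) hxy
    subst h4
    exact ⟨rfl, by simpa using h1⟩

omit [Fintype F] in
theorem hits_eq_sum (W S : Finset F) (h : F × F) :
    (hits W S h : ℝ) = ∑ x ∈ S, if h.1 * x + h.2 ∈ W then (1 : ℝ) else 0 := by
  rw [hits, Finset.card_filter]
  push_cast
  rfl

theorem sum_hits (W S : Finset F) :
    ∑ h, (hits W S h : ℝ) = S.card * (Fintype.card F * W.card) := by
  simp_rw [hits_eq_sum]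
  rw [Finset.sum_comm]
  have : ∀ x ∈ S, ∑ h : F × F, (if h.1 * x + h.2 ∈ W then (1 : ℝ) else 0) =
      Fintype.card F * W.card := by
    intro x _
    rw [Finset.sum_boole, card_affine_mem]
    push_cast
    rfl
  rw [Finset.sum_congr rfl this]
  simp

theorem sum_hits_sq_le (W S : Finset F) :
    ∑ h, (hits W S h : ℝ) ^ 2 ≤
      S.card * (Fintype.card F * W.card) + (S.card : ℝ) ^ 2 * (W.card : ℝ) ^ 2 := by
  have h1 : ∀ h : F × F, (hits W S h : ℝ) ^ 2 = ∑ x ∈ S, ∑ y ∈ S,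
      if h.1 * x + h.2 ∈ W ∧ h.1 * y + h.2 ∈ W then (1 : ℝ) else 0 := by
    intro h
    rw [hits_eq_sum, sq, Finset.sum_mul_sum]
    refine Finset.sum_congr rfl fun x _ => Finset.sum_congr rfl fun y _ => ?_
    by_cases hx : h.1 * x + h.2 ∈ W <;> by_cases hy : h.1 * y + h.2 ∈ W <;> simp [hx, hy]
  have h2 : ∀ x y : F, (∑ h : F × F,
      if h.1 * x + h.2 ∈ W ∧ h.1 * y + h.2 ∈ W then (1 : ℝ) else 0) ≤
      (if x = y then (Fintype.card F * W.card : ℝ) else 0) + (W.card : ℝ) ^ 2 := by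
    intro x y
    rw [Finset.sum_boole]
    split_ifs with hxy
    · subst hxy
      simp only [and_self]
      rw [card_affine_mem]
      push_cast
      nlinarith [sq_nonneg (W.card : ℝ)]
    · rw [zero_add]
      exact_mod_cast card_affine_mem_mem_le W hxy
  simp_rw [h1]
  rw [Finset.sum_comm]
  simp_rw [Finset.sum_comm (s := Finset.univ) (t := S)]
  calc _ ≤ ∑ x ∈ S, ∑ y ∈ S,
        ((if x = y then (Fintype.card F * W.card : ℝ) else 0) + (W.card : ℝ) ^ 2) :=
        Finset.sum_le_sum fun x _ => Finset.sum_le_sum fun y _ => h2 x y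
    _ = _ := by
        simp only [Finset.sum_add_distrib, Finset.sum_ite_eq, Finset.sum_const, nsmul_eq_mul]
        rw [Finset.sum_congr rfl fun x hx => if_pos hx]
        simp
        ring

/-- `μ` is the mean of `hits` over all affine maps; pairwise independence bounds the variance by the
mean. -/
theorem sum_hits_sub_sq_le (W S : Finset F) {μ : ℝ}
    (hμ : μ * Fintype.card F = S.card * W.card) :
    ∑ h, ((hits W S h : ℝ) - μ) ^ 2 ≤ (Fintype.card F : ℝ) ^ 2 * μ := by
  have h1 : ∑ h : F × F, ((hits W S h : ℝ) - μ) ^ 2 =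
      ∑ h, (hits W S h : ℝ) ^ 2 - 2 * μ * ∑ h, (hits W S h : ℝ) +
        (Fintype.card F : ℝ) ^ 2 * μ ^ 2 := by
    simp_rw [sub_sq]
    rw [Finset.sum_add_distrib, Finset.sum_sub_distrib, Finset.mul_sum]
    congr 1
    · congr 1
      exact Finset.sum_congr rfl fun h _ => by ring
    · rw [Finset.sum_const, Finset.card_univ, Fintype.card_prod, nsmul_eq_mul]
      push_cast
      ring
  rw [h1, sum_hits]
  have h2 := sum_hits_sq_le W S
  have h3 : (S.card : ℝ) ^ 2 * (W.card : ℝ) ^ 2 = (μ * Fintype.card F) ^ 2 := by rw [hμ]; ring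
  have h4 : (S.card : ℝ) * (Fintype.card F * W.card) = Fintype.card F * (μ * Fintype.card F) := by
    rw [hμ]; ring
  rw [h3, h4] at h2
  rw [h4]
  nlinarith

/-- The first moment gives `μ`. For `μ ≥ 2`, Chebyshev gives `μ / (μ - 1)² ≤ 4 / μ`; for smaller `μ`
the bound `4 / μ` is trivial. -/
theorem card_hits_eq_one_le (W S : Finset F) {μ : ℝ} (hμ0 : 0 < μ)
    (hμ : μ * Fintype.card F = S.card * W.card) :
    ((Finset.univ.filter fun h => hits W S h = 1).card : ℝ) ≤
      (Fintype.card F : ℝ) ^ 2 * min μ (4 / μ) := by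
  set N := (Finset.univ.filter fun h => hits W S h = 1) with hN
  rw [mul_min_of_nonneg _ _ (by positivity), le_min_iff]
  constructor
  · calc (N.card : ℝ) = ∑ h ∈ N, (hits W S h : ℝ) := by
          rw [Finset.sum_congr rfl fun h hh => by rw [(Finset.mem_filter.1 hh).2]]
          simp
      _ ≤ ∑ h, (hits W S h : ℝ) :=
          Finset.sum_le_sum_of_subset_of_nonneg (Finset.subset_univ _) fun _ _ _ => by positivity
      _ = Fintype.card F * (S.card * W.card) := by rw [sum_hits]; ring
      _ = _ := by rw [← hμ]; ring
  · rw [← mul_div_assoc, le_div_iff₀ hμ0]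
    rcases le_total μ 2 with h2 | h2
    · have h3 : (N.card : ℝ) ≤ (Fintype.card F : ℝ) ^ 2 := by
        have := Finset.card_le_univ N
        rw [Fintype.card_prod, ← sq] at this
        exact_mod_cast this
      nlinarith [sq_nonneg (Fintype.card F : ℝ)]
    · have h3 : (N.card : ℝ) * (1 - μ) ^ 2 ≤ (Fintype.card F : ℝ) ^ 2 * μ := by
        refine le_trans ?_ (sum_hits_sub_sq_le W S hμ)
        calc (N.card : ℝ) * (1 - μ) ^ 2 = ∑ h ∈ N, ((hits W S h : ℝ) - μ) ^ 2 := by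
              rw [Finset.sum_congr rfl fun h hh => by rw [(Finset.mem_filter.1 hh).2]]
              simp
          _ ≤ _ := Finset.sum_le_sum_of_subset_of_nonneg (Finset.subset_univ _)
              fun _ _ _ => by positivity
      have h4 : (N.card : ℝ) * (μ ^ 2 / 4) ≤ N.card * (1 - μ) ^ 2 := by
        gcongr
        nlinarith
      have h5 : (N.card * μ) * μ ≤ ((Fintype.card F : ℝ) ^ 2 * 4) * μ := by nlinarith
      exact le_of_mul_le_mul_right h5 hμ0

/-- Terms double up to the peak and then halve. The right side is a potential that makes the
induction close; only its bound 8 is needed later. -/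
theorem sum_min_geometric_le {c : ℝ} (hc : 0 < c) (m : ℕ) :
    ∑ j ∈ Finset.range m, min (2 ^ j * c) (4 / (2 ^ j * c)) ≤
      if 2 ^ m * c ≤ 4 then 2 ^ m * c else 8 - 16 / (2 ^ m * c) := by
  induction m with
  | zero =>
    rw [Finset.sum_range_zero]
    split_ifs with h
    · positivity
    · have : 16 / (2 ^ 0 * c) ≤ 8 := by
        rw [div_le_iff₀ (by positivity)]
        linarith
      linarith
  | succ m ih =>
    rw [Finset.sum_range_succ]
    set y := 2 ^ m * c with hy
    have hy0 : 0 < y := by positivity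
    have hy2 : 2 ^ (m + 1) * c = 2 * y := by rw [hy]; ring
    rw [hy2]
    have e1 : 4 / y * y = 4 := by field_simp
    have e2 : 16 / y = 4 * (4 / y) := by field_simp; norm_num
    have e3 : 16 / (2 * y) = 2 * (4 / y) := by field_simp; norm_num
    have m1 := min_le_left y (4 / y)
    have m2 := min_le_right y (4 / y)
    rw [e3]
    rw [e2] at ih
    set z := 4 / y
    have hz : 0 < z := by positivity
    by_cases h4 : y ≤ 4
    · rw [if_pos h4] at ih
      by_cases h2 : 2 * y ≤ 4
      · rw [if_pos h2]
        linarith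
      · rw [if_neg h2]
        -- After multiplication by `y` this is `(y - 2) * (6 - y) ≥ 0`, for `2 < y ≤ 4`.
        have : y + 3 * z ≤ 8 := by
          by_contra! hc
          nlinarith [mul_pos (show 0 < y + 3 * z - 8 by linarith) hy0,
            mul_nonneg (show 0 ≤ y - 2 by linarith) (show 0 ≤ 6 - y by linarith)]
        linarith
    · rw [if_neg h4] at ih
      rw [if_neg (by linarith)]
      linarith

theorem sum_card_hits_eq_one_le {m : ℕ} (W : Fin m → Finset F) (hW : ∀ j, (W j).card = 2 ^ (j : ℕ))
    (S : Finset F) :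
    ∑ j, ((Finset.univ.filter fun h => hits (W j) S h = 1).card : ℝ) ≤
      8 * (Fintype.card F : ℝ) ^ 2 := by
  have hq : (0 : ℝ) < Fintype.card F := by exact_mod_cast Fintype.card_pos
  rcases S.eq_empty_or_nonempty with rfl | hS
  · simp only [hits, Finset.filter_empty, Finset.card_empty]
    simp
  · set c : ℝ := S.card / Fintype.card F with hc
    have hc0 : 0 < c := div_pos (by exact_mod_cast hS.card_pos) hq
    calc ∑ j, ((Finset.univ.filter fun h => hits (W j) S h = 1).card : ℝ)
        ≤ ∑ j : Fin m, (Fintype.card F : ℝ) ^ 2 *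
            min (2 ^ (j : ℕ) * c) (4 / (2 ^ (j : ℕ) * c)) := by
          refine Finset.sum_le_sum fun j _ => card_hits_eq_one_le (W j) S (by positivity) ?_
          rw [hW, hc]
          push_cast
          field_simp
      _ = (Fintype.card F : ℝ) ^ 2 *
            ∑ j ∈ Finset.range m, min (2 ^ j * c) (4 / (2 ^ j * c)) := by
          rw [← Finset.mul_sum, Finset.sum_range]
      _ ≤ (Fintype.card F : ℝ) ^ 2 * 8 := by
          gcongr
          refine (sum_min_geometric_le hc0 m).trans ?_
          split_ifs with h
          · linarith
          · have : 0 < 16 / (2 ^ m * c) := by positivity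
            linarith
      _ = _ := mul_comm _ _

end AffineHash

/-! ### Three-layer graphs -/

section ThreeLayers

variable {A N Z : Type}

/-- The source `none` is joined to all nodes of `A` and of `Z`, and `ν : N` to the nodes of `A`
that are `R`-related to it. -/
def threeLayerRel (R : N → A → Prop) : Option (A ⊕ N ⊕ Z) → Option (A ⊕ N ⊕ Z) → Prop
  | none, some (Sum.inl _) => True
  | none, some (Sum.inr (Sum.inr _)) => True
  | some (Sum.inl x), some (Sum.inr (Sum.inl ν)) => R ν x
  | _, _ => False

/-- The graph of `threeLayerRel`. -/
def threeLayerGraph (Z : Type) (R : N → A → Prop) : SimpleGraph (Option (A ⊕ N ⊕ Z)) :=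
  SimpleGraph.fromRel (threeLayerRel R)

theorem threeLayerGraph_adj_middle {R : N → A → Prop} {ν : N} {u : Option (A ⊕ N ⊕ Z)} :
    (threeLayerGraph Z R).Adj (some (Sum.inr (Sum.inl ν))) u ↔
      ∃ x, u = some (Sum.inl x) ∧ R ν x := by
  rw [threeLayerGraph, SimpleGraph.fromRel_adj]
  rcases u with _ | x | ν' | z <;> simp [threeLayerRel]

theorem threeLayerGraph_connected {R : N → A → Prop} (hR : ∀ ν, ∃ x, R ν x) :
    (threeLayerGraph Z R).Connected := by
  have hA : ∀ x, (threeLayerGraph Z R).Adj none (some (Sum.inl x)) := fun x => by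
    simp [threeLayerGraph, threeLayerRel]
  have hZ : ∀ z, (threeLayerGraph Z R).Adj none (some (Sum.inr (Sum.inr z))) := fun z => by
    simp [threeLayerGraph, threeLayerRel]
  have key : ∀ v, (threeLayerGraph Z R).Reachable none v := by
    rintro (_ | x | ν | z)
    · exact SimpleGraph.Reachable.refl _
    · exact (hA x).reachable
    · obtain ⟨x, hx⟩ := hR ν
      exact (hA x).reachable.trans
        (threeLayerGraph_adj_middle.2 ⟨x, rfl, hx⟩).symm.reachable
    · exact (hZ z).reachable
  exact ⟨fun u v => (key u).symm.trans (key v)⟩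

theorem isBottleneck_threeLayerGraph [Fintype N] [Nonempty N] {R : N → A → Prop} {δ : ℝ}
    (hδ : ∀ (S : Set A) (M : Finset N), (∀ ν ∈ M, ∃! x, R ν x ∧ x ∈ S) →
      (M.card : ℝ) ≤ δ * Fintype.card N) :
    IsBottleneck (threeLayerGraph Z R) none
      (Finset.univ.map ⟨fun ν : N => some (Sum.inr (Sum.inl ν)), fun ν ν' h => by simpa using h⟩)
      δ := by
  classical
  refine ⟨by simp, by simp, fun S M hM hS => ?_⟩
  obtain ⟨M', -, rfl⟩ := Finset.subset_map_iff.1 hM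
  rw [Finset.card_map, Finset.card_map, Finset.card_univ]
  refine hδ {x | some (Sum.inl x) ∈ S} M' fun ν hν => ?_
  obtain ⟨u, ⟨hu, huS⟩, huniq⟩ := hS _ (Finset.mem_map_of_mem _ hν)
  obtain ⟨x, rfl, hx⟩ := threeLayerGraph_adj_middle.1 hu
  refine ⟨x, ⟨hx, huS⟩, fun y hy => ?_⟩
  simpa using huniq (some (Sum.inl y)) ⟨threeLayerGraph_adj_middle.2 ⟨y, rfl, hy.1⟩, hy.2⟩

theorem IsBottleneck.comap {V V' : Type} {G : SimpleGraph V} {s : V} {B : Finset V} {δ : ℝ}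
    (hB : IsBottleneck G s B δ) (f : V' ≃ V) :
    IsBottleneck (G.comap f) (f.symm s) (B.map f.symm.toEmbedding) δ := by
  refine ⟨by simpa using hB.source_notMem, by simpa using hB.nonempty, fun S M hM hS => ?_⟩
  rw [Finset.card_map, ← Finset.card_map f.toEmbedding]
  refine hB.card_le {u | f.symm u ∈ S} _ ?_ ?_
  · intro v hv
    obtain ⟨w, hw, rfl⟩ := Finset.mem_map.1 hv
    obtain ⟨v', hv', rfl⟩ := Finset.mem_map.1 (hM hw)
    simpa using hv'
  · intro v hv
    obtain ⟨w, hw, rfl⟩ := Finset.mem_map.1 hv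
    obtain ⟨u, ⟨hu, huS⟩, huniq⟩ := hS w hw
    refine ⟨f u, ⟨hu, by simpa using huS⟩, fun y hy => ?_⟩
    rw [← huniq (f.symm y) ⟨by simpa using hy.1, hy.2⟩, Equiv.apply_symm_apply]

theorem exists_isBottleneck_fin [Fintype A] [Fintype N] [Nonempty N] {R : N → A → Prop}
    (hR : ∀ ν, ∃ x, R ν x) {δ : ℝ}
    (hδ : ∀ (S : Set A) (M : Finset N), (∀ ν ∈ M, ∃! x, R ν x ∧ x ∈ S) →
      (M.card : ℝ) ≤ δ * Fintype.card N) {n : ℕ}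
    (hn : 1 + Fintype.card A + Fintype.card N ≤ n) :
    ∃ (G : SimpleGraph (Fin n)) (s : Fin n) (B : Finset (Fin n)),
      G.Connected ∧ IsBottleneck G s B δ := by
  -- Leaves at the source pad the graph to exactly `n` nodes without affecting the bottleneck.
  let Z := Fin (n - (1 + Fintype.card A + Fintype.card N))
  have hcard : Fintype.card (Fin n) = Fintype.card (Option (A ⊕ N ⊕ Z)) := by
    simp only [Fintype.card_fin, Fintype.card_option, Fintype.card_sum, Z]
    omega
  let f := Fintype.equivOfCardEq hcard
  exact ⟨_, _, _, (SimpleGraph.Iso.comap f (threeLayerGraph Z R)).connected_iff.2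
    (threeLayerGraph_connected hR), (isBottleneck_threeLayerGraph hδ).comap f⟩

end ThreeLayers

/-! ### The worst topology and the final constants -/

section WorstCase

/-- Slopes are units so that every middle node has a neighbour. With `q` the field size, this leaves
`m (q - 1) q ≥ m q² / 2` nodes, of which at most `8 q²` are isolated. -/
theorem exists_isBottleneck_of_field (F : Type) [Field F] [Fintype F] {m : ℕ} (hm : 0 < m)
    (hq : 2 ^ m ≤ Fintype.card F) {n : ℕ}
    (hn : 1 + Fintype.card F + m * ((Fintype.card F - 1) * Fintype.card F) ≤ n) :
    ∃ (G : SimpleGraph (Fin n)) (s : Fin n) (B : Finset (Fin n)),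
      G.Connected ∧ IsBottleneck G s B (16 / m) := by
  classical
  have hW : ∀ j : Fin m, ∃ W : Finset F, W.card = 2 ^ (j : ℕ) := by
    intro j
    obtain ⟨W, -, hW⟩ := Finset.exists_subset_card_eq (s := (Finset.univ : Finset F))
      (n := 2 ^ (j : ℕ)) (by
        rw [Finset.card_univ]
        exact (Nat.pow_le_pow_right (by norm_num) j.2.le).trans hq)
    exact ⟨W, hW⟩
  choose W hW using hW
  let R : Fin m × Fˣ × F → F → Prop := fun ν x => ν.2.1 * x + ν.2.2 ∈ W ν.1
  have : Nonempty (Fin m × Fˣ × F) := ⟨(⟨0, hm⟩, 1, 0)⟩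
  have hcard : Fintype.card (Fin m × Fˣ × F) =
      m * ((Fintype.card F - 1) * Fintype.card F) := by
    rw [Fintype.card_prod, Fintype.card_prod, Fintype.card_fin, Fintype.card_units]
  refine exists_isBottleneck_fin (R := R) ?_ ?_ (hcard ▸ hn)
  · rintro ⟨j, α, β⟩
    obtain ⟨w, hw⟩ : (W j).Nonempty := by
      rw [← Finset.card_pos, hW]
      positivity
    refine ⟨(α : F)⁻¹ * (w - β), ?_⟩
    simpa [R] using hw
  · intro S M hM
    have h1 : M.card ≤ ∑ j, (Finset.univ.filter fun h => hits (W j) S.toFinset h = 1).card := by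
      rw [← Finset.card_sigma]
      refine Finset.card_le_card_of_injOn (fun ν => ⟨ν.1, (ν.2.1, ν.2.2)⟩) ?_ ?_
      · intro ν hν
        obtain ⟨x, hx, huniq⟩ := hM ν hν
        simp only [Finset.coe_sigma, Set.mem_sigma_iff, Finset.mem_coe, Finset.mem_univ,
          Finset.mem_filter, true_and, hits]
        rw [Finset.card_eq_one]
        refine ⟨x, Finset.ext fun y => ?_⟩
        rw [Finset.mem_filter, Set.mem_toFinset, Finset.mem_singleton]
        exact ⟨fun hy => huniq y ⟨hy.2, hy.1⟩, fun hy => hy ▸ ⟨hx.2, hx.1⟩⟩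
      · rintro ⟨j, α, β⟩ - ⟨j', α', β'⟩ - h
        simp only [Sigma.mk.injEq] at h
        obtain ⟨rfl, h⟩ := h
        simpa [Units.ext_iff] using h
    have h2 : (M.card : ℝ) ≤ 8 * (Fintype.card F : ℝ) ^ 2 := by
      refine le_trans ?_ (sum_card_hits_eq_one_le W hW S.toFinset)
      exact_mod_cast h1
    have h3 : 2 ≤ Fintype.card F := Fintype.one_lt_card
    have h4 : (2 : ℝ) ≤ Fintype.card F := by exact_mod_cast h3
    have hm' : (0 : ℝ) < m := by exact_mod_cast hm
    rw [hcard]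
    push_cast [Nat.cast_sub (show 1 ≤ Fintype.card F by omega)]
    rw [← mul_assoc, div_mul_cancel₀ _ hm'.ne']
    nlinarith

theorem exists_isBottleneck {n : ℕ} (hn : 8 ≤ n) :
    ∃ (G : SimpleGraph (Fin n)) (s : Fin n) (B : Finset (Fin n)),
      G.Connected ∧ IsBottleneck G s B (16 / Nat.log 8 n) := by
  have : Fact (Nat.Prime 2) := ⟨Nat.prime_two⟩
  set m := Nat.log 8 n with hm
  have hm0 : 0 < m := Nat.log_pos (by norm_num) hn
  let _ : Fintype (GaloisField 2 m) := Fintype.ofFinite _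
  have hF : Fintype.card (GaloisField 2 m) = 2 ^ m := by
    rw [← Nat.card_eq_fintype_card]
    exact GaloisField.card 2 m hm0.ne'
  refine exists_isBottleneck_of_field (GaloisField 2 m) hm0 hF.ge ?_
  rw [hF]
  have h1 : 8 ^ m ≤ n := Nat.pow_log_le_self 8 (by omega)
  refine le_trans ?_ h1
  have h2 : (8 : ℕ) ^ m = 2 ^ m * 2 ^ m * 2 ^ m := by
    rw [← mul_pow, ← mul_pow]
    norm_num
  have h3 : m + 1 ≤ 2 ^ m := Nat.lt_two_pow_self
  rw [h2]
  obtain ⟨y, hy⟩ := Nat.exists_eq_add_of_le h3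
  rw [hy] at *
  have : m + 1 + y - 1 = m + y := by omega
  rw [this]
  nlinarith [Nat.zero_le (m * y), Nat.zero_le (m * m), Nat.zero_le (y * y),
    Nat.zero_le (m * m * y), Nat.zero_le (m * y * y), Nat.zero_le (y * y * y)]

theorem sixteen_div_log_le {n : ℕ} (hn : 8 ≤ n) :
    (16 : ℝ) / Nat.log 8 n ≤ 96 / Real.log n := by
  have hm0 : 0 < Nat.log 8 n := Nat.log_pos (by norm_num) hn
  have hm1 : (1 : ℝ) ≤ Nat.log 8 n := by exact_mod_cast hm0
  have hn1 : (1 : ℝ) < n := by exact_mod_cast (show 1 < n by omega)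
  have h1 : (n : ℝ) ≤ 8 ^ (Nat.log 8 n + 1) := by
    exact_mod_cast (Nat.lt_pow_succ_log_self (by norm_num) n).le
  have h2 := Real.log_le_log (by linarith) h1
  rw [Real.log_pow] at h2
  have h3 : Real.log 8 ≤ 3 := by
    rw [show (8 : ℝ) = 2 ^ 3 by norm_num, Real.log_pow]
    have := Real.log_two_lt_d9
    norm_num
    linarith
  -- With `m = Nat.log 8 n ≥ 1`, `log n ≤ 3 (m + 1) ≤ 6 m`.
  rw [div_le_div_iff₀ (by linarith) (Real.log_pos hn1)]
  push_cast at h2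
  nlinarith

variable {p a b : ℝ}

theorem worstRoutingThroughput_le {n : ℕ} (hn : 8 ≤ n) :
    worstRoutingThroughput p n ≤ ENNReal.ofReal (96 / Real.log n) := by
  obtain ⟨G, s, B, hG, hB⟩ := exists_isBottleneck hn
  have hm0 : 0 < Nat.log 8 n := Nat.log_pos (by norm_num) hn
  exact (iInf₂_le_of_le G hG (iInf_le _ s)).trans
    ((hB.routingThroughput_le (by positivity) p).trans
      (ENNReal.ofReal_le_ofReal (sixteen_div_log_le hn)))

theorem worstCodingThroughput_le (hp0 : 0 ≤ p) (hp1 : p ≤ 1) (ha : 0 < a) (hb : 0 < b) {n : ℕ}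
    (hn : 8 ≤ n) :
    worstCodingThroughput p a b n ≤ ENNReal.ofReal (6 * b / a * 96 / Real.log n) := by
  obtain ⟨G, s, B, hG, hB⟩ := exists_isBottleneck hn
  have hm0 : 0 < Nat.log 8 n := Nat.log_pos (by norm_num) hn
  refine (iInf₂_le_of_le G hG (iInf_le _ s)).trans
    ((hB.codingThroughput_le (by positivity) hp0 hp1 ha hb).trans (ENNReal.ofReal_le_ofReal ?_))
  calc 6 * b * (16 / Nat.log 8 n) / a = 6 * b / a * (16 / Nat.log 8 n) := by ring
    _ ≤ 6 * b / a * (96 / Real.log n) := by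
        gcongr ?_ * ?_
        exact sixteen_div_log_le hn
    _ = _ := by ring

theorem exists_block_factor (hp0 : 0 ≤ p) (hp1 : p < 1) :
    ∃ C : ℕ, ((1 + p) / 2) ^ C ≤ 1 / 4 ∧ 2 ≤ C := by
  have h0 : 0 ≤ (1 + p) / 2 := by linarith
  have h1 : (1 + p) / 2 < 1 := by linarith
  obtain ⟨C, hC⟩ := exists_pow_lt_of_lt_one (show (0 : ℝ) < 1 / 4 by norm_num) h1
  refine ⟨C + 2, le_trans ?_ hC.le, by omega⟩
  exact pow_le_pow_of_le_one h0 h1.le (by omega)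

theorem exists_le_worstThroughput (hp0 : 0 ≤ p) (hp1 : p < 1) (ha : 0 < a) (hab : a ≤ b) :
    ∃ c : ℝ, 0 < c ∧ ∀ n : ℕ, 8 ≤ n →
      ENNReal.ofReal (c / Real.log n) ≤ worstRoutingThroughput p n ∧
      ENNReal.ofReal (c / Real.log n) ≤ worstCodingThroughput p a b n := by
  obtain ⟨C, hC, hC2⟩ := exists_block_factor hp0 hp1
  have hC0 : (0 : ℝ) < C := by exact_mod_cast (show 0 < C by omega)
  -- For `n ≥ 8`, `1 + log n ≤ 2 log n`, which doubles `6 C`.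
  refine ⟨1 / (12 * C), by positivity, fun n hn => ?_⟩
  have hlog : 1 ≤ Real.log n := by
    rw [Real.le_log_iff_exp_le (by positivity)]
    have : (8 : ℝ) ≤ n := by exact_mod_cast hn
    linarith [Real.exp_one_lt_d9]
  have hD : 0 < 6 * C * (1 + Real.log n) := by positivity
  have hle : 1 / (12 * C) / Real.log n ≤ 1 / (6 * C * (1 + Real.log n)) := by
    rw [div_div]
    exact one_div_le_one_div_of_le hD (by nlinarith)
  constructor <;> refine le_iInf₂ fun G hG => le_iInf fun s =>
    (ENNReal.ofReal_le_ofReal hle).trans (ofReal_le_throughput hD ?_)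
  · exact (frequently_feasible hp0 hp1 ha hab hC hC2 hG s).mono fun k ⟨T, hT, hle⟩ =>
      ⟨T, hT.1, hle⟩
  · exact (frequently_feasible hp0 hp1 ha hab hC hC2 hG s).mono fun k ⟨T, hT, hle⟩ =>
      ⟨T, hT.2, hle⟩

theorem ofReal_le_div_of_bounds {x y : ℝ≥0∞} {c C l : ℝ} (hc : 0 < c) (hC : 0 < C) (hl : 0 < l)
    (hx : ENNReal.ofReal (c / l) ≤ x) (hx' : x ≤ ENNReal.ofReal (C / l))
    (hy : ENNReal.ofReal (c / l) ≤ y) (hy' : y ≤ ENNReal.ofReal (C / l)) :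
    ENNReal.ofReal (c / C) ≤ x / y ∧ x / y ≤ ENNReal.ofReal (C / c) := by
  constructor
  · refine le_trans ?_ (ENNReal.div_le_div hx hy')
    rw [← ENNReal.ofReal_div_of_pos (by positivity), div_div_div_cancel_right₀ hl.ne']
  · refine (ENNReal.div_le_div hx' hy).trans ?_
    rw [← ENNReal.ofReal_div_of_pos (by positivity), div_div_div_cancel_right₀ hl.ne']

end WorstCase

end NoisyRadio

theorem mainTheorem2 (p a b : ℝ) (hp0 : 0 ≤ p) (hp1 : p < 1) (ha : 0 < a) (hab : a ≤ b) :
    ∃ c C : ℝ, 0 < c ∧ 0 < C ∧ ∃ N : ℕ, ∀ n : ℕ, N ≤ n →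
      (ENNReal.ofReal (c / Real.log n) ≤ NoisyRadio.worstCodingThroughput p a b n ∧
        NoisyRadio.worstCodingThroughput p a b n ≤ ENNReal.ofReal (C / Real.log n)) ∧
      (ENNReal.ofReal (c / Real.log n) ≤ NoisyRadio.worstRoutingThroughput p n ∧
        NoisyRadio.worstRoutingThroughput p n ≤ ENNReal.ofReal (C / Real.log n)) ∧
      (ENNReal.ofReal c ≤ NoisyRadio.worstCaseTopologyGap p a b n ∧
        NoisyRadio.worstCaseTopologyGap p a b n ≤ ENNReal.ofReal C) := by
  have hb : 0 < b := ha.trans_le hab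
  obtain ⟨c₀, hc₀, hlower⟩ := NoisyRadio.exists_le_worstThroughput hp0 hp1 ha hab
  set C₀ : ℝ := 96 + 6 * b / a * 96 with hC₀_def
  have hC₀ : 0 < C₀ := by positivity
  have hcm : min c₀ (c₀ / C₀) ≤ c₀ := min_le_left _ _
  have hCM : C₀ ≤ max C₀ (C₀ / c₀) := le_max_left _ _
  -- The quotients `c₀ / C₀` and `C₀ / c₀` are the bounds for the gap, where `log n` cancels.
  refine ⟨min c₀ (c₀ / C₀), max C₀ (C₀ / c₀), by positivity, by positivity, 8, fun n hn => ?_⟩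
  have hn1 : (1 : ℝ) < n := by exact_mod_cast (show 1 < n by omega)
  have hl : 0 < Real.log n := Real.log_pos hn1
  obtain ⟨hRl, hCl⟩ := hlower n hn
  have hR : NoisyRadio.worstRoutingThroughput p n ≤ ENNReal.ofReal (C₀ / Real.log n) := by
    refine (NoisyRadio.worstRoutingThroughput_le hn).trans (ENNReal.ofReal_le_ofReal ?_)
    gcongr
    exact le_add_of_nonneg_right (by positivity)
  have hC : NoisyRadio.worstCodingThroughput p a b n ≤ ENNReal.ofReal (C₀ / Real.log n) := by
    refine (NoisyRadio.worstCodingThroughput_le hp0 hp1.le ha hb hn).trans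
      (ENNReal.ofReal_le_ofReal ?_)
    gcongr
    exact le_add_of_nonneg_left (by positivity)
  have hc : ENNReal.ofReal (min c₀ (c₀ / C₀) / Real.log n) ≤
      ENNReal.ofReal (c₀ / Real.log n) := ENNReal.ofReal_le_ofReal (by gcongr)
  have hC' : ENNReal.ofReal (C₀ / Real.log n) ≤
      ENNReal.ofReal (max C₀ (C₀ / c₀) / Real.log n) := ENNReal.ofReal_le_ofReal (by gcongr)
  obtain ⟨hg1, hg2⟩ := NoisyRadio.ofReal_le_div_of_bounds hc₀ hC₀ hl hCl hC hRl hR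
  exact ⟨⟨hc.trans hCl, hC.trans hC'⟩, ⟨hc.trans hRl, hR.trans hC'⟩,
    (ENNReal.ofReal_le_ofReal (min_le_right _ _)).trans hg1,
    hg2.trans (ENNReal.ofReal_le_ofReal (le_max_right _ _))⟩
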